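/- Let $\lambda\in\mathbb{R}$, $\lambda\neq 0$, and let $\mathfrak{g}_\kappa$ (with $\kappa=\lambda^{-1}$) be the two-dimensional $\kappa$-Minkowski Lie algebra: the complex Lie algebra with basis $x_1,x_2$ and bracket $[x_1,x_2]=i\lambda x_2$. Let $U=U(\mathfrak{g}_\kappa)$ be its universal enveloping algebra. For a $\mathbb{C}$-algebra automorphism $\sigma$ of $U$ let ${}_\sigma U$ be the vector space $U$ with the $U$-bimodule structure $a\cdot b\cdot c=\sigma(a)bc$, and let $H_n(U,{}_\sigma U)$ be the Hochschild homology of $U$ with coefficients in ${}_\sigma U$, i.e. the homology of the complex ${}_\sigma U\otimes U^{\otimes n}$ with the Hochschild boundary. The twisted Hochschild dimension of $U$ is the largest $n$ such that $H_n(U,{}_\sigma U)\neq 0$ for some automorphism $\sigma$ of $U$. Then the twisted Hochschild dimension of $U(\mathfrak{g}_\kappa)$ is equal to $2$. Moreover, for $\mu\in\mathbb{C}$ let $\sigma_\mu$ be the automorphism of $U$ with $\sigma_\mu(x_1)=x_1+i\mu$ and $\sigma_\mu(x_2)=x_2$, and let $M={}_{\sigma_\mu}U$, regarded as a left $\mathfrak{g}_\kappa$-module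 by $X(m)=\sigma_\mu(X)m-mX$. Then each of the following holds if and only if $\mu=-\lambda(1+b)$ for some $b\in\mathbb{N}_0$: (a) there is a nonzero cycle of top degree in the Chevalley–Eilenberg complex of $\mathfrak{g}_\kappa$ with coefficients in $M$, i.e. a nonzero $c\in M\otimes\Lambda^2\mathfrak{g}_\kappa$ with $\delta c=0$, where $\delta(m\otimes X_1\wedge X_2)=-m\otimes[X_1,X_2]-X_1(m)\otimes X_2+X_2(m)\otimes X_1$; (b) $H_2(U,{}_{\sigma_\mu}U)\neq 0$. -/

import Mathlib

open scoped TensorProduct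

noncomputable section

namespace KappaMinkowski

attribute [local instance 100] LieRing.ofAssociativeRing

/-! ### Hochschild homology of an algebra with coefficients in a bimodule

An `A`-bimodule over `k` is a `k`-module `M` with a left action of `A` and a right action of `A`
(that is, a left action of `Aᵐᵒᵖ`) which commute and extend the action of `k`. (That the two
actions commute, `SMulCommClass A Aᵐᵒᵖ M`, makes the boundary below square to zero; it is not needed
to write the boundary down.) -/

section Hochschild

variable (k A M : Type*) [CommRing k] [Ring A] [Algebra k A] [AddCommGroup M] [Module k M]
  [Module A M] [Module Aᵐᵒᵖ M] [IsScalarTower k A M] [IsScalarTower k Aᵐᵒᵖ M]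

/-- The Hochschild chains `M ⊗ A^{⊗ n}`. -/
abbrev HochschildChain (n : ℕ) : Type _ := M ⊗[k] (⨂[k]^n A)

variable {A M}

/-- The Hochschild boundary of `m ⊗ a₀ ⊗ ⋯ ⊗ aₙ`, namely
`m a₀ ⊗ a₁ ⊗ ⋯ ⊗ aₙ + ∑_{j < n} (-1)^{j+1} m ⊗ a₀ ⊗ ⋯ ⊗ aⱼ aⱼ₊₁ ⊗ ⋯ ⊗ aₙ`
`+ (-1)^{n+1} aₙ m ⊗ a₀ ⊗ ⋯ ⊗ aₙ₋₁`. -/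
def hochschildBoundaryFun (n : ℕ) (m : M) (a : Fin (n + 1) → A) : HochschildChain k A M n :=
  (MulOpposite.op (a 0) • m) ⊗ₜ[k] PiTensorProduct.tprod k (Fin.tail a)
    + ∑ j : Fin n, (-1 : k) ^ ((j : ℕ) + 1) •
        (m ⊗ₜ[k] PiTensorProduct.tprod k (Fin.contractNth j.castSucc (· * ·) a))
    + (-1 : k) ^ (n + 1) •
        ((a (Fin.last n) • m) ⊗ₜ[k] PiTensorProduct.tprod k (Fin.init a))

theorem contractNth_update {n : ℕ} [DecidableEq (Fin (n + 1))] (j : Fin n) (a : Fin (n + 1) → A)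
    (i : Fin (n + 1)) : ∃ (p : Fin n) (f : A →ₗ[k] A), ∀ x,
      Fin.contractNth j.castSucc (· * ·) (Function.update a i x) =
        Function.update (Fin.contractNth j.castSucc (· * ·) a) p (f x) := by
  rcases lt_trichotomy (i : ℕ) j with h | h | h
  · refine ⟨⟨i, by omega⟩, LinearMap.id, fun x => funext fun q => ?_⟩
    simp only [Fin.contractNth, Function.update_apply, Fin.ext_iff, Fin.val_castSucc,
      Fin.val_succ, LinearMap.id_apply]
    split_ifs <;> first | rfl | omega
  · refine ⟨j, LinearMap.mulRight k (a j.succ), fun x => funext fun q => ?_⟩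
    have hi : i = j.castSucc := Fin.ext h
    subst hi
    by_cases hq : q = j
    · subst hq
      simp [Fin.contractNth, Fin.ext_iff]
    · have hq' : (q : ℕ) ≠ j := fun h => hq (Fin.ext h)
      simp only [Fin.contractNth, Function.update_apply, Fin.ext_iff, Fin.val_castSucc,
        Fin.val_succ]
      split_ifs <;> first | rfl | omega
  · by_cases h1 : (i : ℕ) = j + 1
    · refine ⟨j, LinearMap.mulLeft k (a j.castSucc), fun x => funext fun q => ?_⟩
      have hi : i = j.succ := Fin.ext (by simpa using h1)
      subst hi
      by_cases hq : q = j
      · subst hq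
        simp [Fin.contractNth, Fin.ext_iff]
      · have hq' : (q : ℕ) ≠ j := fun h => hq (Fin.ext h)
        simp only [Fin.contractNth, Function.update_apply, Fin.ext_iff, Fin.val_castSucc,
          Fin.val_succ]
        split_ifs <;> first | rfl | omega
    · refine ⟨⟨i - 1, by omega⟩, LinearMap.id, fun x => funext fun q => ?_⟩
      simp only [Fin.contractNth, Function.update_apply, Fin.ext_iff, Fin.val_castSucc,
        Fin.val_succ, LinearMap.id_apply]
      split_ifs <;> first | rfl | omega

theorem hochschildBoundaryFun_update (n : ℕ) [DecidableEq (Fin (n + 1))] (m : M)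
    (a : Fin (n + 1) → A) (i : Fin (n + 1)) : ∃ g : A →ₗ[k] HochschildChain k A M n,
      ∀ x, hochschildBoundaryFun k n m (Function.update a i x) = g x := by
  have h1 : ∃ g : A →ₗ[k] HochschildChain k A M n, ∀ x,
      (MulOpposite.op (Function.update a i x 0) • m) ⊗ₜ[k]
        PiTensorProduct.tprod k (Fin.tail (Function.update a i x)) = g x := by
    refine Fin.cases ?_ (fun i => ?_) i
    · refine ⟨(TensorProduct.mk k M _).flip (PiTensorProduct.tprod k (Fin.tail a)) ∘ₗ
        { toFun := fun x => MulOpposite.op x • m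
          map_add' := fun x y => by rw [MulOpposite.op_add, add_smul]
          map_smul' := fun c x => by rw [MulOpposite.op_smul, smul_assoc, RingHom.id_apply] },
        fun x => ?_⟩
      have : Fin.tail (Function.update a 0 x) = Fin.tail a := by
        funext q; simp [Fin.tail]
      simp [this]
    · refine ⟨TensorProduct.mk k M _ (MulOpposite.op (a 0) • m) ∘ₗ
        (PiTensorProduct.tprod k).toLinearMap (Fin.tail a) i, fun x => ?_⟩
      have : Fin.tail (Function.update a i.succ x) = Function.update (Fin.tail a) i x := by
        funext q; simp [Fin.tail, Function.update_apply]
      simp [this, (Fin.succ_ne_zero i).symm]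
  have h2 (j : Fin n) : ∃ g : A →ₗ[k] HochschildChain k A M n, ∀ x,
      m ⊗ₜ[k] PiTensorProduct.tprod k
        (Fin.contractNth j.castSucc (· * ·) (Function.update a i x)) = g x := by
    obtain ⟨p, f, h⟩ := contractNth_update k j a i
    refine ⟨TensorProduct.mk k M _ m ∘ₗ (PiTensorProduct.tprod k).toLinearMap
      (Fin.contractNth j.castSucc (· * ·) a) p ∘ₗ f, fun x => ?_⟩
    rw [h]
    simp
  have h3 : ∃ g : A →ₗ[k] HochschildChain k A M n, ∀ x,
      (Function.update a i x (Fin.last n) • m) ⊗ₜ[k]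
        PiTensorProduct.tprod k (Fin.init (Function.update a i x)) = g x := by
    refine Fin.lastCases ?_ (fun i => ?_) i
    · refine ⟨(TensorProduct.mk k M _).flip (PiTensorProduct.tprod k (Fin.init a)) ∘ₗ
        { toFun := fun x => x • m
          map_add' := fun x y => by rw [add_smul]
          map_smul' := fun c x => by rw [smul_assoc, RingHom.id_apply] },
        fun x => ?_⟩
      have : Fin.init (Function.update a (Fin.last n) x) = Fin.init a := by
        funext q; simp [Fin.init, Fin.castSucc_ne_last]
      simp [this]
    · refine ⟨TensorProduct.mk k M _ (a (Fin.last n) • m) ∘ₗ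
        (PiTensorProduct.tprod k).toLinearMap (Fin.init a) i, fun x => ?_⟩
      have : Fin.init (Function.update a i.castSucc x) = Function.update (Fin.init a) i x := by
        funext q; simp [Fin.init, Function.update_apply]
      simp [this, (Fin.castSucc_ne_last i).symm]
  obtain ⟨g1, h1⟩ := h1
  choose g2 h2 using h2
  obtain ⟨g3, h3⟩ := h3
  refine ⟨g1 + ∑ j : Fin n, (-1 : k) ^ ((j : ℕ) + 1) • g2 j + (-1 : k) ^ (n + 1) • g3,
    fun x => ?_⟩
  simp only [hochschildBoundaryFun, h1, h2, h3, LinearMap.add_apply, LinearMap.smul_apply,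
    LinearMap.sum_apply]

/-- The Hochschild boundary `b : M ⊗ A^{⊗ (n+1)} → M ⊗ A^{⊗ n}`, that is, the linear map which
takes `m ⊗ a₀ ⊗ ⋯ ⊗ aₙ` to `hochschildBoundaryFun k n m a`. -/
def hochschildBoundary (n : ℕ) :
    HochschildChain k A M (n + 1) →ₗ[k] HochschildChain k A M n :=
  TensorProduct.lift
    { toFun := fun m => PiTensorProduct.lift
        { toFun := hochschildBoundaryFun k n m
          map_update_add' := fun a i x y => by
            obtain ⟨g, hg⟩ := hochschildBoundaryFun_update k n m a i
            simp only [hg, map_add]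
          map_update_smul' := fun a i c x => by
            obtain ⟨g, hg⟩ := hochschildBoundaryFun_update k n m a i
            simp only [hg, map_smul] }
      map_add' := fun m m' => by
        refine PiTensorProduct.ext (MultilinearMap.ext fun a => ?_)
        simp only [LinearMap.compMultilinearMap_apply, PiTensorProduct.lift.tprod,
          LinearMap.add_apply, MultilinearMap.coe_mk, hochschildBoundaryFun, smul_add,
          TensorProduct.add_tmul, Finset.sum_add_distrib]
        abel
      map_smul' := fun c m => by
        refine PiTensorProduct.ext (MultilinearMap.ext fun a => ?_)
        have hl (x : A) : x • c • m = c • x • m := smul_comm _ _ _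
        have hr (x : Aᵐᵒᵖ) : x • c • m = c • x • m := by
          rw [← algebraMap_smul Aᵐᵒᵖ c m, ← algebraMap_smul Aᵐᵒᵖ c (x • m), smul_smul, smul_smul,
            Algebra.commutes]
        simp only [LinearMap.compMultilinearMap_apply, PiTensorProduct.lift.tprod,
          LinearMap.smul_apply, MultilinearMap.coe_mk, hochschildBoundaryFun, hl, hr,
          RingHom.id_apply, smul_add, Finset.smul_sum, ← TensorProduct.smul_tmul',
          smul_smul, mul_comm c] }

theorem hochschildBoundary_tmul_tprod (n : ℕ) (m : M) (a : Fin (n + 1) → A) :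
    hochschildBoundary k n (m ⊗ₜ[k] PiTensorProduct.tprod k a) =
      hochschildBoundaryFun k n m a := by
  simp [hochschildBoundary]

variable (A M)

/-- The Hochschild cycles of degree `n`; in degree `0` every chain is a cycle. -/
def hochschildCycles : (n : ℕ) → Submodule k (HochschildChain k A M n)
  | 0 => ⊤
  | n + 1 => LinearMap.ker (hochschildBoundary k n)

/-- The Hochschild homology `Hₙ(A, M)`: cycles modulo boundaries. -/
abbrev HochschildHomology (n : ℕ) : Type _ :=
  hochschildCycles k A M n ⧸
    (LinearMap.range (hochschildBoundary (A := A) (M := M) k n)).submoduleOf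
      (hochschildCycles k A M n)

end Hochschild

/-! ### Twisted coefficients and the twisted Hochschild dimension -/

section Twisted

variable {k A : Type*} [CommRing k] [Ring A] [Algebra k A]

/-- The bimodule `_σ A`: the `k`-module `A` with the bimodule structure `a · b · c = σ(a) b c`. -/
def TwistedBimodule (_σ : A ≃ₐ[k] A) : Type _ := A

namespace TwistedBimodule

variable (σ : A ≃ₐ[k] A)

instance : AddCommGroup (TwistedBimodule σ) := inferInstanceAs (AddCommGroup A)

instance : Module k (TwistedBimodule σ) := inferInstanceAs (Module k A)

/-- The identity map from `A` to `_σ A`. -/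
def of : A ≃ₗ[k] TwistedBimodule σ := LinearEquiv.refl k A

instance : Module A (TwistedBimodule σ) where
  smul a m := of σ (σ a * (of σ).symm m)
  one_smul m := show σ 1 * (show A from m) = m by rw [map_one, one_mul]
  mul_smul a b m := show σ (a * b) * (show A from m) = σ a * (σ b * (show A from m)) by
    rw [map_mul, mul_assoc]
  smul_zero a := mul_zero (σ a)
  smul_add a := mul_add (σ a)
  add_smul a b m := show σ (a + b) * (show A from m) = σ a * (show A from m) + σ b * (show A from m)
    by rw [map_add, add_mul]
  zero_smul m := show σ 0 * (show A from m) = (0 : A) by rw [map_zero, zero_mul]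

instance : Module Aᵐᵒᵖ (TwistedBimodule σ) where
  smul c m := of σ ((of σ).symm m * c.unop)
  one_smul m := mul_one (show A from m)
  mul_smul c d m := (mul_assoc (show A from m) d.unop c.unop).symm
  smul_zero c := zero_mul c.unop
  smul_add c m m' := add_mul (show A from m) (show A from m') c.unop
  add_smul c d m := mul_add (show A from m) c.unop d.unop
  zero_smul m := mul_zero (show A from m)

theorem smul_def (a : A) (m : TwistedBimodule σ) : a • m = of σ (σ a * (of σ).symm m) := rfl

theorem op_smul_def (c : A) (m : TwistedBimodule σ) :
    MulOpposite.op c • m = of σ ((of σ).symm m * c) := rfl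

instance : SMulCommClass A Aᵐᵒᵖ (TwistedBimodule σ) where
  smul_comm a c m := (mul_assoc (σ a) (show A from m) c.unop).symm

instance : IsScalarTower k A (TwistedBimodule σ) where
  smul_assoc c a m := show σ (c • a) * (show A from m) = c • (σ a * (show A from m)) by
    rw [map_smul, smul_mul_assoc]

instance : IsScalarTower k Aᵐᵒᵖ (TwistedBimodule σ) where
  smul_assoc c a m := mul_smul_comm c (show A from m) a.unop

end TwistedBimodule

variable (k A)

/-- The twisted Hochschild dimension: the largest degree `n` (as a supremum in `ℕ∞`) such that
`Hₙ(A, _σ A) ≠ 0` for some `k`-algebra automorphism `σ` of `A`. -/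
def twistedHochschildDimension : ℕ∞ :=
  ⨆ σ : A ≃ₐ[k] A, ⨆ n : ℕ, ⨆ _ : Nontrivial (HochschildHomology k A (TwistedBimodule σ) n), (n : ℕ∞)

end Twisted

/-! ### The Chevalley–Eilenberg complex in degree two -/

section ChevalleyEilenberg

variable {k L : Type*} [CommRing k] [LieRing L] [LieAlgebra k L]

/-- The left `L`-module `M^{ad}` of a `U(L)`-bimodule `M`, as a representation of `L` on `M`:
`X(m) = X m - m X`. -/
def adRep (M : Type*) [AddCommGroup M] [Module k M]
    [Module (UniversalEnvelopingAlgebra k L) M] [Module (UniversalEnvelopingAlgebra k L)ᵐᵒᵖ M]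
    [SMulCommClass (UniversalEnvelopingAlgebra k L) (UniversalEnvelopingAlgebra k L)ᵐᵒᵖ M]
    [IsScalarTower k (UniversalEnvelopingAlgebra k L) M]
    [IsScalarTower k (UniversalEnvelopingAlgebra k L)ᵐᵒᵖ M] :
    L →ₗ⁅k⁆ Module.End k M where
  toFun X :=
    { toFun := fun m => UniversalEnvelopingAlgebra.ι k X • m
        - MulOpposite.op (UniversalEnvelopingAlgebra.ι k X) • m
      map_add' := fun m m' => by simp only [smul_add]; abel
      map_smul' := fun c m => by
        have hr (x : (UniversalEnvelopingAlgebra k L)ᵐᵒᵖ) : x • c • m = c • x • m := by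
          rw [← algebraMap_smul (UniversalEnvelopingAlgebra k L)ᵐᵒᵖ c m,
            ← algebraMap_smul (UniversalEnvelopingAlgebra k L)ᵐᵒᵖ c (x • m), smul_smul, smul_smul,
            Algebra.commutes]
        rw [hr, smul_comm, RingHom.id_apply, smul_sub] }
  map_add' X Y := LinearMap.ext fun m => by
    simp only [LinearMap.coe_mk, AddHom.coe_mk, LinearMap.add_apply, map_add, MulOpposite.op_add,
      add_smul]
    abel
  map_smul' c X := LinearMap.ext fun m => by
    simp only [LinearMap.coe_mk, AddHom.coe_mk, LinearMap.smul_apply, map_smul,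
      MulOpposite.op_smul, smul_assoc, smul_sub, RingHom.id_apply]
  map_lie' {X Y} := LinearMap.ext fun m => by
    have h : UniversalEnvelopingAlgebra.ι k ⁅X, Y⁆ =
        UniversalEnvelopingAlgebra.ι k X * UniversalEnvelopingAlgebra.ι k Y -
          UniversalEnvelopingAlgebra.ι k Y * UniversalEnvelopingAlgebra.ι k X := by
      rw [LieHom.map_lie, LieRing.of_associative_ring_bracket]
    simp only [LinearMap.coe_mk, AddHom.coe_mk, h, LieRing.of_associative_ring_bracket,
      LinearMap.sub_apply, Module.End.mul_apply, MulOpposite.op_sub, MulOpposite.op_mul, sub_smul,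
      smul_sub, mul_smul, smul_comm (UniversalEnvelopingAlgebra.ι k X)
        (MulOpposite.op (UniversalEnvelopingAlgebra.ι k Y)),
      smul_comm (UniversalEnvelopingAlgebra.ι k Y)
        (MulOpposite.op (UniversalEnvelopingAlgebra.ι k X))]
    abel

variable {M : Type*} [AddCommGroup M] [Module k M]

/-- The Chevalley–Eilenberg differential `δ : M ⊗ Λ² L → M ⊗ L` of a left `L`-module `M`,
`δ(m ⊗ X₁ ∧ X₂) = - m ⊗ [X₁, X₂] - X₁(m) ⊗ X₂ + X₂(m) ⊗ X₁`. -/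
def chevalleyEilenbergTwo (ρ : L →ₗ⁅k⁆ Module.End k M) :
    M ⊗[k] (⋀[k]^2 L) →ₗ[k] M ⊗[k] L :=
  TensorProduct.lift
    { toFun := fun m => exteriorPower.alternatingMapLinearEquiv
        { toFun := fun X => - m ⊗ₜ[k] ⁅X 0, X 1⁆ - ρ (X 0) m ⊗ₜ[k] X 1 + ρ (X 1) m ⊗ₜ[k] X 0
          map_update_add' := fun X i Y Z => by
            fin_cases i <;>
            simp [TensorProduct.tmul_add, TensorProduct.add_tmul] <;> abel
          map_update_smul' := fun X i c Y => by
            fin_cases i <;>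
            simp [TensorProduct.tmul_smul, ← TensorProduct.smul_tmul',
              smul_sub, smul_add]
          map_eq_zero_of_eq' := fun X i j h hij => by
            have h01 : X 0 = X 1 := by
              fin_cases i <;> fin_cases j <;> simp_all
            simp [h01] }
      map_add' := fun m m' => by
        ext X
        simp [TensorProduct.add_tmul]
        abel
      map_smul' := fun c m => by
        ext X
        simp [← TensorProduct.smul_tmul', smul_sub, smul_add] }

theorem chevalleyEilenbergTwo_tmul (ρ : L →ₗ⁅k⁆ Module.End k M) (m : M) (X : Fin 2 → L) :
    chevalleyEilenbergTwo ρ (m ⊗ₜ[k] exteriorPower.ιMulti k 2 X) =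
      - m ⊗ₜ[k] ⁅X 0, X 1⁆ - ρ (X 0) m ⊗ₜ[k] X 1 + ρ (X 1) m ⊗ₜ[k] X 0 := by
  simp [chevalleyEilenbergTwo]

end ChevalleyEilenberg

/-! ### The two-dimensional κ-Minkowski Lie algebra and its twists -/

/-- The two-dimensional κ-Minkowski Lie algebra `g_κ` over `ℂ`, with `lam = κ⁻¹`: the space `ℂ²`
with standard basis `x₁, x₂` and the bracket determined by `[x₁, x₂] = i lam x₂`. -/
def Lie (_lam : ℝ) : Type := Fin 2 → ℂ

namespace Lie

variable (lam : ℝ)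

instance : AddCommGroup (Lie lam) := inferInstanceAs (AddCommGroup (Fin 2 → ℂ))

instance : Module ℂ (Lie lam) := inferInstanceAs (Module ℂ (Fin 2 → ℂ))

/-- The first basis vector (the time coordinate). -/
def x₁ : Lie lam := (![1, 0] : Fin 2 → ℂ)

/-- The second basis vector (the space coordinate). -/
def x₂ : Lie lam := (![0, 1] : Fin 2 → ℂ)

instance : LieRing (Lie lam) where
  bracket X Y := ((X 0 * Y 1 - Y 0 * X 1) * (Complex.I * lam)) • x₂ lam
  add_lie X Y Z := by
    rw [← add_smul]; congr 1
    simp only [show ∀ i, (X + Y) i = X i + Y i from fun _ => rfl]; ring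
  lie_add X Y Z := by
    rw [← add_smul]; congr 1
    simp only [show ∀ i, (Y + Z) i = Y i + Z i from fun _ => rfl]; ring
  lie_self X := by
    show ((X 0 * X 1 - X 0 * X 1) * (Complex.I * lam)) • x₂ lam = 0
    rw [sub_self, zero_mul, zero_smul]
  leibniz_lie X Y Z := by
    rw [← add_smul]; congr 1
    have h0 (c : ℂ) : (c • x₂ lam : Lie lam) 0 = 0 := mul_zero c
    have h1 (c : ℂ) : (c • x₂ lam : Lie lam) 1 = c := mul_one c
    simp only [h0, h1]; ring

instance : LieAlgebra ℂ (Lie lam) where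
  lie_smul c X Y := by
    show ((X 0 * (c * Y 1) - (c * Y 0) * X 1) * (Complex.I * lam)) • x₂ lam =
      c • (((X 0 * Y 1 - Y 0 * X 1) * (Complex.I * lam)) • x₂ lam)
    rw [smul_smul]; congr 1; ring

theorem lie_x₁_x₂ : ⁅x₁ lam, x₂ lam⁆ = (Complex.I * lam) • x₂ lam := by
  show (((1 : ℂ) * 1 - 0 * 0) * (Complex.I * lam)) • x₂ lam = _
  congr 1; ring

end Lie

/-- The enveloping algebra `U(g_κ)`. -/
abbrev U (lam : ℝ) : Type := UniversalEnvelopingAlgebra ℂ (Lie lam)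

/-- The Lie homomorphism `g_κ → U(g_κ)` with `x₁ ↦ x₁ + i μ` and `x₂ ↦ x₂`. -/
def twistLieHom (lam : ℝ) (μ : ℂ) : Lie lam →ₗ⁅ℂ⁆ U lam where
  toFun X := UniversalEnvelopingAlgebra.ι ℂ X + algebraMap ℂ (U lam) (X 0 * (Complex.I * μ))
  map_add' X Y := by
    rw [show (X + Y) 0 = X 0 + Y 0 from rfl, map_add, add_mul, map_add]; abel
  map_smul' c X := by
    rw [show (c • X) 0 = c * X 0 from rfl, map_smul, mul_assoc, RingHom.id_apply, smul_add,
      map_mul, Algebra.smul_def c (algebraMap ℂ (U lam) _)]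
  map_lie' {X Y} := by
    have h0 : (⁅X, Y⁆ : Lie lam) 0 = 0 := mul_zero _
    rw [h0, zero_mul, map_zero, add_zero, LieHom.map_lie, LieRing.of_associative_ring_bracket,
      LieRing.of_associative_ring_bracket]
    have hc (c : ℂ) (u : U lam) : u * algebraMap ℂ (U lam) c = algebraMap ℂ (U lam) c * u :=
      (Algebra.commutes c u).symm
    simp only [add_mul, mul_add, hc (Y 0 * (Complex.I * μ))]
    rw [hc (X 0 * (Complex.I * μ)) (UniversalEnvelopingAlgebra.ι ℂ Y)]
    abel

/-- The algebra endomorphism of `U(g_κ)` with `x₁ ↦ x₁ + i μ` and `x₂ ↦ x₂`. -/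
def twistHom (lam : ℝ) (μ : ℂ) : U lam →ₐ[ℂ] U lam :=
  UniversalEnvelopingAlgebra.lift ℂ (twistLieHom lam μ)

theorem twistHom_ι (lam : ℝ) (μ : ℂ) (X : Lie lam) :
    twistHom lam μ (UniversalEnvelopingAlgebra.ι ℂ X) =
      UniversalEnvelopingAlgebra.ι ℂ X + algebraMap ℂ (U lam) (X 0 * (Complex.I * μ)) :=
  UniversalEnvelopingAlgebra.lift_ι_apply ℂ (twistLieHom lam μ) X

theorem twistHom_comp (lam : ℝ) (μ ν : ℂ) (h : μ + ν = 0) :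
    (twistHom lam μ).comp (twistHom lam ν) = AlgHom.id ℂ (U lam) := by
  refine UniversalEnvelopingAlgebra.hom_ext ℂ (LieHom.ext fun X => ?_)
  show twistHom lam μ (twistHom lam ν (UniversalEnvelopingAlgebra.ι ℂ X)) =
    UniversalEnvelopingAlgebra.ι ℂ X
  rw [twistHom_ι, map_add, twistHom_ι, AlgHom.commutes, add_assoc, ← map_add, ← mul_add,
    ← mul_add, h, mul_zero, mul_zero, map_zero, add_zero]

/-- The automorphism `σ` of `U(g_κ)` with `σ(x₁) = x₁ + i μ` and `σ(x₂) = x₂`. -/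
def twist (lam : ℝ) (μ : ℂ) : U lam ≃ₐ[ℂ] U lam :=
  AlgEquiv.ofAlgHom (twistHom lam μ) (twistHom lam (-μ))
    (twistHom_comp lam μ (-μ) (add_neg_cancel μ)) (twistHom_comp lam (-μ) μ (neg_add_cancel μ))

theorem twist_x₁ (lam : ℝ) (μ : ℂ) :
    twist lam μ (UniversalEnvelopingAlgebra.ι ℂ (Lie.x₁ lam)) =
      UniversalEnvelopingAlgebra.ι ℂ (Lie.x₁ lam) + algebraMap ℂ (U lam) (Complex.I * μ) := by
  refine (twistHom_ι lam μ (Lie.x₁ lam)).trans ?_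
  rw [show (Lie.x₁ lam) 0 = 1 from rfl, one_mul]

theorem twist_x₂ (lam : ℝ) (μ : ℂ) :
    twist lam μ (UniversalEnvelopingAlgebra.ι ℂ (Lie.x₂ lam)) =
      UniversalEnvelopingAlgebra.ι ℂ (Lie.x₂ lam) := by
  refine (twistHom_ι lam μ (Lie.x₂ lam)).trans ?_
  rw [show (Lie.x₂ lam) 0 = 0 from rfl, zero_mul, map_zero, add_zero]

end KappaMinkowski

end

noncomputable section

namespace KappaMinkowski

attribute [local instance 100] LieRing.ofAssociativeRing

/-! ### Hochschild cochains with values in a bimodule -/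

/-! Over a field, the transpose of the Hochschild boundary on `M ⊗ A^{⊗ n}` is the coboundary on
cochains with values in the dual bimodule `M*`. So `Hₙ(U, M)` vanishes wherever the cohomology of
`M*` does, and a cycle on which some cocycle is nonzero is not a boundary. The work is done in
cohomology, from the presentation of `U` by `x₁, x₂` and one relation.

A 2-cocycle `f` defines a square-zero extension of `U` by `N`. Splitting it means lifting the two
generators so that the relation still holds, so `f` is a coboundary once its defect on the relation
lies in the image of the linearized relation `relator : N × N → N` (`exists_coboundary_two`).
Conversely every element of `N` is the defect of some cocycle (`exists_cocycle_two`).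

For degrees at least three, replace `N` by the quotient of the coinduced bimodule `Hom(U, N)` by
`N`; this lowers the degree by one (`exists_coboundary_of_reduced`) and ends in degree two. There
the relator is onto: the equation to be solved is a recursion along right multiplication by `x₂`,
solvable because the PBW theorem makes `U` the direct sum of the spaces `ℂ[x₁] x₂ⁿ`.

In degree two, the relator of `M*` is the transpose of `m ↦ (-[x₁, m] - iλm, [x₂, m])`, whose kernel
consists of the `m` with `m ⊗ x₁ ∧ x₂` a Chevalley–Eilenberg cycle. Hence `H₂ ≠ 0` exactly when a
nonzero top cycle exists. For the twist by `μ`, a top cycle is a `u ∈ U` commuting with `x₂` such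
that `[x₁, u] = -i(μ + λ)u`. Since `ad x₁` is the scalar `niλ` on `ℂ[x₁] x₂ⁿ`, a nonzero solution
forces `μ = -λ(1 + n)`, and then `x₂ⁿ` is one. -/

/-- A bimodule structure on `N` over the `k`-algebra `A`, given by the linear operators `l a` and
`r a` of left and right multiplication by `a`. -/
structure Bimod (k A N : Type*) [CommRing k] [Ring A] [Algebra k A] [AddCommGroup N]
    [Module k N] where
  /-- Left multiplication. -/
  l : A →ₗ[k] N →ₗ[k] N
  /-- Right multiplication. -/
  r : A →ₗ[k] N →ₗ[k] N
  l_one : ∀ n, l 1 n = n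
  r_one : ∀ n, r 1 n = n
  l_mul : ∀ a b n, l (a * b) n = l a (l b n)
  r_mul : ∀ a b n, r (a * b) n = r b (r a n)
  l_r : ∀ a b n, l a (r b n) = r b (l a n)

namespace Bimod

section Cochains

variable {k A N : Type*} [CommRing k] [Ring A] [Algebra k A] [AddCommGroup N] [Module k N]
  (B : Bimod k A N)

/-- The Hochschild coboundary of a function of `n` variables. -/
def coboundary (n : ℕ) (f : (Fin n → A) → N) (a : Fin (n + 1) → A) : N :=
  B.l (a 0) (f (Fin.tail a))
    + ∑ j : Fin n, (-1 : k) ^ ((j : ℕ) + 1) • f (Fin.contractNth j.castSucc (· * ·) a)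
    + (-1 : k) ^ (n + 1) • B.r (a (Fin.last n)) (f (Fin.init a))

theorem contractNth_zero_cons {n : ℕ} (c : A) (a : Fin (n + 1) → A) :
    Fin.contractNth (0 : Fin (n + 1)).castSucc (· * ·) (Fin.cons c a : Fin (n + 2) → A) =
      Fin.cons (c * a 0) (Fin.tail a) := by
  funext q
  refine Fin.cases ?_ (fun q => ?_) q
  · simp [Fin.contractNth]
  · simp [Fin.contractNth, Fin.tail]

theorem contractNth_succ_cons {n : ℕ} (j : Fin n) (c : A) (a : Fin (n + 1) → A) :
    Fin.contractNth j.succ.castSucc (· * ·) (Fin.cons c a : Fin (n + 2) → A) =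
      Fin.cons c (Fin.contractNth j.castSucc (· * ·) a) := by
  funext q
  refine Fin.cases ?_ (fun q => ?_) q
  · simp [Fin.contractNth]
  · simp [Fin.contractNth]

theorem init_cons {α : Type*} {n : ℕ} (c : α) (a : Fin (n + 1) → α) :
    Fin.init (Fin.cons c a : Fin (n + 2) → α) = Fin.cons c (Fin.init a) := by
  funext q
  refine Fin.cases ?_ (fun q => ?_) q
  · simp [Fin.init]
  · simp [Fin.init]

/-- The coboundary of `f` in terms of that of `f` with its first variable fixed. -/
theorem coboundary_cons (n : ℕ) (f : (Fin (n + 1) → A) → N) (c : A) (a : Fin (n + 1) → A) :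
    B.coboundary (n + 1) f (Fin.cons c a) =
      B.l c (f a) - f (Fin.cons (c * a 0) (Fin.tail a)) + B.l (a 0) (f (Fin.cons c (Fin.tail a)))
        - B.coboundary n (fun a => f (Fin.cons c a)) a := by
  -- The inner coboundary contains a zeroth term `a₀ f(c, tail a)` that has no counterpart on the
  -- left; the third summand cancels it.
  simp only [coboundary, Fin.cons_zero, Fin.tail_cons]
  rw [Fin.sum_univ_succ, contractNth_zero_cons]
  simp only [contractNth_succ_cons, init_cons, Fin.val_succ, Fin.val_zero, zero_add, pow_one,
    neg_smul, one_smul, pow_succ _ (_ + 1), mul_neg, mul_one, Finset.sum_neg_distrib,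
    ← Fin.succ_last, Fin.cons_succ]
  abel

/-! ### The reduced coinduced bimodule -/

/-- The linear maps `A → N` that vanish at `1`. -/
abbrev Reduced (k A N : Type*) [CommRing k] [Ring A] [Algebra k A] [AddCommGroup N]
    [Module k N] : Submodule k (A →ₗ[k] N) := LinearMap.ker (LinearMap.applyₗ (1 : A))

theorem Reduced.apply_one (j : Reduced k A N) : j.1 1 = 0 := j.2

/-- The quotient of the coinduced bimodule `Hom(A, N)` by `N`, realized on the maps which vanish
at `1`: `(b j)(c) = j(c b) - c j(b)` and `(j b)(c) = j(c) b`. -/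
def reduced : Bimod k A (Reduced k A N) where
  l := LinearMap.mk₂ k
    -- A class in `Hom(A, N)/N` has a unique representative vanishing at `1`, obtained from `h` by
    -- subtracting `c ↦ c h(1)`; for `c ↦ j(c b)` the correction is `c j(b)`.
    (fun b j => ⟨j.1 ∘ₗ LinearMap.mulRight k b - B.l.flip (j.1 b), by
      simp [B.l_one]⟩)
    (fun b b' j => Subtype.ext <| LinearMap.ext fun c => by simp [mul_add]; abel)
    (fun t b j => Subtype.ext <| LinearMap.ext fun c => by simp [smul_sub])
    (fun b j j' => Subtype.ext <| LinearMap.ext fun c => by simp; abel)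
    (fun t b j => Subtype.ext <| LinearMap.ext fun c => by simp [smul_sub])
  r := LinearMap.mk₂ k
    (fun b j => ⟨B.r b ∘ₗ j.1, by simp [Reduced.apply_one j]⟩)
    (fun b b' j => Subtype.ext <| LinearMap.ext fun c => by simp)
    (fun t b j => Subtype.ext <| LinearMap.ext fun c => by simp)
    (fun b j j' => Subtype.ext <| LinearMap.ext fun c => by simp)
    (fun t b j => Subtype.ext <| LinearMap.ext fun c => by simp)
  l_one j := Subtype.ext <| LinearMap.ext fun c => by simp [Reduced.apply_one j]
  r_one j := Subtype.ext <| LinearMap.ext fun c => by simp [B.r_one]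
  l_mul a b j := Subtype.ext <| LinearMap.ext fun c => by simp [B.l_mul, mul_assoc]
  r_mul a b j := Subtype.ext <| LinearMap.ext fun c => by simp [B.r_mul]
  l_r a b j := Subtype.ext <| LinearMap.ext fun c => by simp [B.l_r]

theorem reduced_l_apply (b c : A) (j : Reduced k A N) :
    (B.reduced.l b j).1 c = j.1 (c * b) - B.l c (j.1 b) := rfl

theorem reduced_r_apply (b c : A) (j : Reduced k A N) :
    (B.reduced.r b j).1 c = B.r b (j.1 c) := rfl

/-- A coboundary with values in the reduced coinduced bimodule is, up to sign, the coboundary of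
the function with one more variable. -/
theorem coboundary_reduced (n : ℕ) (g : (Fin n → A) → Reduced k A N) (c : A)
    (a : Fin (n + 1) → A) :
    (B.reduced.coboundary n g a).1 c =
      - B.coboundary (n + 1) (fun a => (g (Fin.tail a)).1 (a 0)) (Fin.cons c a) := by
  rw [coboundary_cons]
  simp only [coboundary, Submodule.coe_add, LinearMap.add_apply, reduced_l_apply,
    Submodule.coe_sum, LinearMap.sum_apply, Submodule.coe_smul, LinearMap.smul_apply,
    reduced_r_apply, Fin.cons_zero, Fin.tail_cons]
  abel

/-- A multilinear map as a linear function of its first variable. -/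
def firstVariable {n : ℕ} (f : MultilinearMap k (fun _ : Fin (n + 1) => A) N) (a : Fin n → A) :
    A →ₗ[k] N where
  toFun c := f (Fin.cons c a)
  map_add' c c' := f.cons_add a c c'
  map_smul' t c := f.cons_smul a t c

/-- The cochain `a ↦ (c ↦ f(c, a) - c f(1, a))`. -/
def curryReduced {n : ℕ} (f : MultilinearMap k (fun _ : Fin (n + 1) => A) N) :
    MultilinearMap k (fun _ : Fin n => A) (Reduced k A N) where
  toFun a := ⟨firstVariable f a - B.l.flip (firstVariable f a 1), by simp [B.l_one]⟩
  map_update_add' a i x y := Subtype.ext <| LinearMap.ext fun c => by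
    have h (c : A) : firstVariable f (Function.update a i (x + y)) c =
        firstVariable f (Function.update a i x) c + firstVariable f (Function.update a i y) c :=
      (f.curryLeft c).map_update_add a i x y
    simp [h]
    abel
  map_update_smul' a i t x := Subtype.ext <| LinearMap.ext fun c => by
    have h (c : A) : firstVariable f (Function.update a i (t • x)) c =
        t • firstVariable f (Function.update a i x) c :=
      (f.curryLeft c).map_update_smul a i t x
    simp [h, smul_sub]

theorem curryReduced_apply {n : ℕ} (f : MultilinearMap k (fun _ : Fin (n + 1) => A) N)
    (a : Fin n → A) (c : A) :
    (B.curryReduced f a).1 c = f (Fin.cons c a) - B.l c (f (Fin.cons 1 a)) := rfl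

/-- The cochain `(c, a) ↦ g(a)(c)`. -/
def uncurryReduced {n : ℕ} (g : MultilinearMap k (fun _ : Fin n => A) (Reduced k A N)) :
    MultilinearMap k (fun _ : Fin (n + 1) => A) N :=
  LinearMap.uncurryLeft (M := fun _ : Fin (n + 1) => A)
    { toFun := fun c => ((LinearMap.applyₗ c) ∘ₗ (Reduced k A N).subtype).compMultilinearMap g
      map_add' := fun c c' => by ext; simp
      map_smul' := fun t c => by ext; simp }

theorem uncurryReduced_apply {n : ℕ} (g : MultilinearMap k (fun _ : Fin n => A) (Reduced k A N))
    (a : Fin (n + 1) → A) : uncurryReduced g a = (g (Fin.tail a)).1 (a 0) := rfl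

theorem coboundary_sub (n : ℕ) (f g : (Fin n → A) → N) (a : Fin (n + 1) → A) :
    B.coboundary n (fun a => f a - g a) a = B.coboundary n f a - B.coboundary n g a := by
  simp only [coboundary, map_sub, smul_sub, Finset.sum_sub_distrib]
  abel

/-- Left multiplication by `c` commutes with all faces but the zeroth, where `c` and `a₀` act in the
opposite order. -/
theorem coboundary_l (n : ℕ) (f : (Fin n → A) → N) (c : A) (a : Fin (n + 1) → A) :
    B.coboundary n (fun a => B.l c (f a)) a = B.l c (B.coboundary n f a)
      - B.l c (B.l (a 0) (f (Fin.tail a))) + B.l (a 0) (B.l c (f (Fin.tail a))) := by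
  simp only [coboundary, map_add, map_sum, map_smul, B.l_r]
  abel

/-- The cochain `f(1, ·)` of a cocycle `f`. -/
theorem coboundary_cons_one (n : ℕ) (f : (Fin (n + 1) → A) → N)
    (hf : ∀ a, B.coboundary (n + 1) f a = 0) (a : Fin (n + 1) → A) :
    B.coboundary n (fun a => f (Fin.cons 1 a)) a = B.l (a 0) (f (Fin.cons 1 (Fin.tail a))) := by
  have h := B.coboundary_cons n f 1 a
  rw [hf, B.l_one, one_mul, Fin.cons_self_tail, sub_self, zero_add] at h
  exact (sub_eq_zero.mp h.symm).symm

/-- The dimension shift on cocycles: the extra terms coming from the normalization `c f(1, a)` are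
evaluated by `coboundary_cons_one` and cancel. -/
theorem coboundary_curryReduced (n : ℕ) (f : MultilinearMap k (fun _ : Fin (n + 1) => A) N)
    (hf : ∀ a, B.coboundary (n + 1) f a = 0) (a : Fin (n + 1) → A) :
    B.reduced.coboundary n (B.curryReduced f) a = 0 := by
  refine Subtype.ext (LinearMap.ext fun c => ?_)
  have h := B.coboundary_cons n f c a
  have h1 := B.coboundary_cons_one n f hf a
  rw [hf] at h
  rw [coboundary_reduced, coboundary_cons]
  simp only [curryReduced_apply, Fin.cons_zero, Fin.tail_cons]
  rw [coboundary_sub, coboundary_l, h1]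
  simp only [Fin.cons_self_tail, B.l_mul, map_sub, ZeroMemClass.coe_zero, LinearMap.zero_apply]
  rw [eq_comm, sub_eq_zero] at h
  rw [← h]
  abel

/-- Dimension shifting: if every cocycle of degree `n + 1` with values in the reduced coinduced
bimodule is a coboundary, then so is every cocycle of degree `n + 2` with values in `N`. -/
theorem exists_coboundary_of_reduced (n : ℕ)
    (H : ∀ f : MultilinearMap k (fun _ : Fin (n + 1) => A) (Reduced k A N),
      (∀ a, B.reduced.coboundary (n + 1) f a = 0) →
        ∃ g : MultilinearMap k (fun _ : Fin n => A) (Reduced k A N),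
          ∀ a, f a = B.reduced.coboundary n g a)
    (f : MultilinearMap k (fun _ : Fin (n + 2) => A) N)
    (hf : ∀ a, B.coboundary (n + 2) f a = 0) :
    ∃ g : MultilinearMap k (fun _ : Fin (n + 1) => A) N, ∀ a, f a = B.coboundary (n + 1) g a := by
  obtain ⟨g, hg⟩ := H (B.curryReduced f) (B.coboundary_curryReduced _ f hf)
  -- The coboundary of `f(1, ·)` is `a₀ f(1, tail a)`, and that of `-uncurryReduced g` is `f(a) - a₀
  -- f(1, tail a)`; they add up to `f`.
  refine ⟨f.curryLeft 1 - uncurryReduced g, fun a => ?_⟩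
  have h := congrArg (fun j => j.1 (a 0)) (hg (Fin.tail a))
  simp only [curryReduced_apply, coboundary_reduced, Fin.cons_self_tail] at h
  refine Eq.trans ?_ (B.coboundary_sub (n + 1) (fun a => f (Fin.cons 1 a)) (uncurryReduced g) a).symm
  rw [B.coboundary_cons_one _ f hf, sub_eq_iff_eq_add.mp h, neg_add_eq_sub]
  rfl

end Cochains

end Bimod

/-! ### Generators and relations of the enveloping algebra -/

section Generators

variable (lam : ℝ)

/-- The generator `x₁` of `U(g_κ)`. -/
def genX : U lam := UniversalEnvelopingAlgebra.ι ℂ (Lie.x₁ lam)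

/-- The generator `x₂` of `U(g_κ)`. -/
def genY : U lam := UniversalEnvelopingAlgebra.ι ℂ (Lie.x₂ lam)

theorem genX_mul_genY_sub :
    genX lam * genY lam - genY lam * genX lam = (Complex.I * lam) • genY lam := by
  rw [genX, genY, ← LieRing.of_associative_ring_bracket, ← LieHom.map_lie, Lie.lie_x₁_x₂, map_smul]

variable {lam}

theorem Lie.eq_smul_add_smul (v : Lie lam) : v = v 0 • Lie.x₁ lam + v 1 • Lie.x₂ lam := by
  funext i
  show v i = v 0 * (![1, 0] : Fin 2 → ℂ) i + v 1 * (![0, 1] : Fin 2 → ℂ) i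
  fin_cases i <;> simp

variable {E : Type*} [Ring E] [Algebra ℂ E]

/-- The homomorphism out of `U(g_κ)` determined by two elements with `p q - q p = i lam q`. -/
def liftGen (p q : E) (h : p * q - q * p = (Complex.I * lam) • q) : U lam →ₐ[ℂ] E :=
  UniversalEnvelopingAlgebra.lift ℂ
    { toFun := fun v => v 0 • p + v 1 • q
      map_add' := fun v w => by
        rw [show (v + w) 0 = v 0 + w 0 from rfl, show (v + w) 1 = v 1 + w 1 from rfl, add_smul,
          add_smul]
        abel
      map_smul' := fun c v => by
        rw [show (c • v) 0 = c * v 0 from rfl, show (c • v) 1 = c * v 1 from rfl, smul_add,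
          smul_smul, smul_smul, RingHom.id_apply]
      map_lie' := fun {v w} => by
        have h0 : (⁅v, w⁆ : Lie lam) 0 = 0 := mul_zero _
        have h1 : (⁅v, w⁆ : Lie lam) 1 = (v 0 * w 1 - w 0 * v 1) * (Complex.I * lam) := mul_one _
        rw [h0, h1, zero_smul, zero_add, mul_smul, ← h, LieRing.of_associative_ring_bracket]
        simp only [add_mul, mul_add, smul_mul_smul_comm, smul_sub, sub_smul, mul_comm (w _)]
        abel }

theorem liftGen_genX (p q : E) (h : p * q - q * p = (Complex.I * lam) • q) :
    liftGen p q h (genX lam) = p := by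
  refine (UniversalEnvelopingAlgebra.lift_ι_apply ℂ _ _).trans ?_
  show (1 : ℂ) • p + (0 : ℂ) • q = p
  simp

theorem liftGen_genY (p q : E) (h : p * q - q * p = (Complex.I * lam) • q) :
    liftGen p q h (genY lam) = q := by
  refine (UniversalEnvelopingAlgebra.lift_ι_apply ℂ _ _).trans ?_
  show (0 : ℂ) • p + (1 : ℂ) • q = q
  simp

theorem algHom_ext {φ ψ : U lam →ₐ[ℂ] E} (hX : φ (genX lam) = ψ (genX lam))
    (hY : φ (genY lam) = ψ (genY lam)) : φ = ψ := by
  refine UniversalEnvelopingAlgebra.hom_ext ℂ (LieHom.ext fun v => ?_)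
  show φ (UniversalEnvelopingAlgebra.ι ℂ v) = ψ (UniversalEnvelopingAlgebra.ι ℂ v)
  rw [Lie.eq_smul_add_smul v]
  simp only [map_add, map_smul]
  exact congrArg₂ (fun a b => v 0 • a + v 1 • b) hX hY

/-- A subalgebra of `U(g_κ)` which contains both generators is everything. -/
theorem mem_of_gen_mem (S : Subalgebra ℂ (U lam)) (hX : genX lam ∈ S) (hY : genY lam ∈ S)
    (u : U lam) : u ∈ S := by
  let φ : U lam →ₐ[ℂ] S := liftGen ⟨genX lam, hX⟩ ⟨genY lam, hY⟩
    (Subtype.ext (genX_mul_genY_sub lam))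
  have h : S.val.comp φ = AlgHom.id ℂ (U lam) :=
    algHom_ext (by simp [φ, liftGen_genX]) (by simp [φ, liftGen_genY])
  have hu : (φ u : U lam) = u := DFunLike.congr_fun h u
  exact hu ▸ (φ u).2

end Generators

/-! ### Cocycles of degree two on the enveloping algebra -/

namespace Bimod

variable {lam : ℝ} {N : Type*} [AddCommGroup N] [Module ℂ N] (B : Bimod ℂ (U lam) N)

/-- Left multiplication by `(n, b)` in the extension of `U(g_κ)` by `N` with cocycle `f`. -/
def extensionMul (f : U lam →ₗ[ℂ] U lam →ₗ[ℂ] N) (b : U lam) (n : N) :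
    Module.End ℂ (N × U lam) :=
  (B.l b ∘ₗ LinearMap.fst ℂ N (U lam) + (B.r.flip n + f b) ∘ₗ LinearMap.snd ℂ N (U lam)).prod
    (LinearMap.mulLeft ℂ b ∘ₗ LinearMap.snd ℂ N (U lam))

theorem extensionMul_apply (f : U lam →ₗ[ℂ] U lam →ₗ[ℂ] N) (b : U lam) (n : N) (v : N × U lam) :
    B.extensionMul f b n v = (B.l b v.1 + (B.r v.2 n + f b v.2), b * v.2) := rfl

/-- The cocycle identity is associativity of the extension. Using operators on `N × U` avoids
constructing a ring structure there. -/
theorem extensionMul_mul (f : U lam →ₗ[ℂ] U lam →ₗ[ℂ] N)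
    (hf : ∀ a b c, B.l a (f b c) - f (a * b) c + f a (b * c) - B.r c (f a b) = 0)
    (b b' : U lam) (n n' : N) :
    B.extensionMul f b n * B.extensionMul f b' n' =
      B.extensionMul f (b * b') (B.l b n' + B.r b' n + f b b') := by
  refine LinearMap.ext fun v => Prod.ext ?_ (mul_assoc b b' v.2).symm
  simp only [Module.End.mul_apply, extensionMul_apply, map_add, B.l_mul, B.r_mul, B.l_r]
  have h := hf b b' v.2
  rw [sub_eq_zero, sub_add_eq_add_sub, sub_eq_iff_eq_add] at h
  rw [← sub_eq_zero]
  rw [← sub_eq_zero] at h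
  rw [← h]
  abel

theorem extensionMul_add (f : U lam →ₗ[ℂ] U lam →ₗ[ℂ] N) (b b' : U lam) (n n' : N) :
    B.extensionMul f (b + b') (n + n') = B.extensionMul f b n + B.extensionMul f b' n' := by
  refine LinearMap.ext fun v => Prod.ext ?_ (add_mul b b' v.2)
  simp only [LinearMap.add_apply, extensionMul_apply, map_add, Prod.fst_add]
  abel

theorem extensionMul_smul (f : U lam →ₗ[ℂ] U lam →ₗ[ℂ] N) (t : ℂ) (b : U lam) (n : N) :
    B.extensionMul f (t • b) (t • n) = t • B.extensionMul f b n := by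
  refine LinearMap.ext fun v => Prod.ext ?_ (smul_mul_assoc t b v.2)
  simp only [LinearMap.smul_apply, extensionMul_apply, map_smul, Prod.smul_fst, smul_add]

/-- As `f` need not be normalized, the unit of the extension is `(-f(1, 1), 1)`; the cocycle
identity at `(1, 1, c)` gives `f(1, c) = f(1, 1) c`. -/
theorem extensionMul_one (f : U lam →ₗ[ℂ] U lam →ₗ[ℂ] N)
    (hf : ∀ a b c, B.l a (f b c) - f (a * b) c + f a (b * c) - B.r c (f a b) = 0) :
    B.extensionMul f 1 (- f 1 1) = 1 := by
  refine LinearMap.ext fun v => Prod.ext ?_ (one_mul v.2)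
  have h := hf 1 1 v.2
  rw [B.l_one, one_mul, one_mul, sub_self, zero_add, sub_eq_zero] at h
  simp only [extensionMul_apply, B.l_one, map_neg, h, neg_add_cancel, add_zero,
    Module.End.one_apply]

/-- A cocycle `f` of degree two is a coboundary as soon as it is one on the relation
`x₁ x₂ - x₂ x₁ = i lam x₂`. -/
theorem exists_coboundary_two (f : U lam →ₗ[ℂ] U lam →ₗ[ℂ] N)
    (hf : ∀ a b c, B.l a (f b c) - f (a * b) c + f a (b * c) - B.r c (f a b) = 0) (n₁ n₂ : N)
    (h : (B.l (genX lam) n₂ + B.r (genY lam) n₁ + f (genX lam) (genY lam))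
      - (B.l (genY lam) n₁ + B.r (genX lam) n₂ + f (genY lam) (genX lam))
        = (Complex.I * lam) • n₂) :
    ∃ g : U lam →ₗ[ℂ] N, g (genX lam) = n₁ ∧ g (genY lam) = n₂ ∧
      ∀ a b, g (a * b) = B.l a (g b) + B.r b (g a) + f a b := by
  have hrel : B.extensionMul f (genX lam) n₁ * B.extensionMul f (genY lam) n₂
      - B.extensionMul f (genY lam) n₂ * B.extensionMul f (genX lam) n₁
      = (Complex.I * lam) • B.extensionMul f (genY lam) n₂ := by
    rw [B.extensionMul_mul f hf, B.extensionMul_mul f hf, ← extensionMul_smul, ← h,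
      ← genX_mul_genY_sub, sub_eq_iff_eq_add, ← extensionMul_add, sub_add_cancel, sub_add_cancel]
  let Φ := liftGen (lam := lam) _ _ hrel
  -- The operator of `(n, b)` sends `(0, 1)` to `(n + f(b, 1), b)`; subtracting `f(b, 1)` recovers
  -- `n`.
  let g : U lam →ₗ[ℂ] N :=
    LinearMap.fst ℂ N (U lam) ∘ₗ LinearMap.applyₗ ((0 : N), (1 : U lam)) ∘ₗ Φ.toLinearMap
      - f.flip 1
  have key {b : U lam} {n : N} (hb : Φ b = B.extensionMul f b n) : g b = n := by
    show (Φ b (0, 1)).1 - f b 1 = n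
    rw [hb, extensionMul_apply]
    simp [B.r_one]
  -- `Φ` lands a priori in all endomorphisms. The elements it sends to extension operators over
  -- themselves form a subalgebra containing the generators.
  let S : Subalgebra ℂ (U lam) :=
    { carrier := {b | ∃ n, Φ b = B.extensionMul f b n}
      mul_mem' := fun {b b'} ⟨n, hn⟩ ⟨n', hn'⟩ =>
        ⟨_, by rw [map_mul, hn, hn', B.extensionMul_mul f hf]⟩
      add_mem' := fun {b b'} ⟨n, hn⟩ ⟨n', hn'⟩ =>
        ⟨_, by rw [map_add, hn, hn', ← extensionMul_add]⟩
      algebraMap_mem' := fun t => ⟨t • - f 1 1, by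
        rw [AlgHom.commutes, Algebra.algebraMap_eq_smul_one, Algebra.algebraMap_eq_smul_one,
          extensionMul_smul, B.extensionMul_one f hf]⟩ }
  have hS (b : U lam) : Φ b = B.extensionMul f b (g b) := by
    obtain ⟨n, hn⟩ : b ∈ S :=
      mem_of_gen_mem S ⟨n₁, liftGen_genX _ _ hrel⟩ ⟨n₂, liftGen_genY _ _ hrel⟩ b
    rw [key hn, hn]
  refine ⟨g, key (liftGen_genX _ _ hrel), key (liftGen_genY _ _ hrel), fun a b => key ?_⟩
  rw [map_mul, hS, hS b, B.extensionMul_mul f hf]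

end Bimod

/-! ### The Poincaré–Birkhoff–Witt basis -/

section PBW

open Polynomial

variable (lam : ℝ)

/-- The substitution `p(X) ↦ p(X - i lam)`. -/
abbrev polyShift : ℂ[X] →ₐ[ℂ] ℂ[X] := aeval (X - C (Complex.I * lam))

/-- From `x₂ x₁ = (x₁ - iλ) x₂`; this dictates the shift in `pbwY`. -/
theorem genY_mul_aeval (p : ℂ[X]) :
    genY lam * aeval (genX lam) p = aeval (genX lam) (polyShift lam p) * genY lam := by
  have hYX : genY lam * genX lam =
      (genX lam - algebraMap ℂ (U lam) (Complex.I * lam)) * genY lam := by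
    rw [sub_mul, ← Algebra.smul_def, ← genX_mul_genY_sub, sub_sub_cancel]
  induction p using Polynomial.induction_on with
  | C t => simp [Algebra.commutes]
  | add p q hp hq => simp only [map_add, mul_add, add_mul, hp, hq]
  | monomial n t h =>
    rw [pow_succ, ← mul_assoc, map_mul, ← mul_assoc, h, mul_assoc, aeval_X, hYX, map_mul, map_mul,
      ← mul_assoc]
    simp

/-- The action of `x₁` on `⊕ₖ ℂ[X] Yᵏ`. -/
def pbwX : Module.End ℂ (ℕ →₀ ℂ[X]) :=
  Finsupp.mapRange.linearMap (LinearMap.mulLeft ℂ (X : ℂ[X]))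

/-- The action of `x₂` on `⊕ₖ ℂ[X] Yᵏ`. -/
def pbwY : Module.End ℂ (ℕ →₀ ℂ[X]) :=
  Finsupp.lmapDomain ℂ[X] ℂ Nat.succ ∘ₗ Finsupp.mapRange.linearMap (polyShift lam).toLinearMap

theorem pbwX_single (n : ℕ) (p : ℂ[X]) :
    pbwX (Finsupp.single n p) = Finsupp.single n (X * p) := by
  simp [pbwX]

theorem pbwY_single (n : ℕ) (p : ℂ[X]) :
    pbwY lam (Finsupp.single n p) = Finsupp.single (n + 1) (polyShift lam p) := by
  simp [pbwY]

theorem pbwX_mul_pbwY_sub :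
    pbwX * pbwY lam - pbwY lam * pbwX = (Complex.I * lam) • pbwY lam := by
  refine Finsupp.lhom_ext fun n p => ?_
  simp only [LinearMap.sub_apply, Module.End.mul_apply, LinearMap.smul_apply, pbwX_single,
    pbwY_single, ← Finsupp.single_sub, Finsupp.smul_single, map_mul, aeval_X, smul_eq_C_mul]
  congr 1
  ring

/-- The action of `U(g_κ)` on `⊕ₖ ℂ[X] Yᵏ`. -/
def pbwAction : U lam →ₐ[ℂ] Module.End ℂ (ℕ →₀ ℂ[X]) :=
  liftGen pbwX (pbwY lam) (pbwX_mul_pbwY_sub lam)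

/-- The map `Σ pₖ Yᵏ ↦ Σ pₖ(x₁) x₂ᵏ`. -/
def pbwMap : (ℕ →₀ ℂ[X]) →ₗ[ℂ] U lam :=
  Finsupp.lsum ℂ fun n => LinearMap.mulRight ℂ (genY lam ^ n) ∘ₗ (aeval (genX lam)).toLinearMap

theorem pbwMap_single (n : ℕ) (p : ℂ[X]) :
    pbwMap lam (Finsupp.single n p) = aeval (genX lam) p * genY lam ^ n := by
  simp [pbwMap]

theorem pbwMap_pbwX (v : ℕ →₀ ℂ[X]) : pbwMap lam (pbwX v) = genX lam * pbwMap lam v := by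
  have h : pbwMap lam ∘ₗ pbwX = LinearMap.mulLeft ℂ (genX lam) ∘ₗ pbwMap lam :=
    Finsupp.lhom_ext fun n p => by
      simp only [LinearMap.comp_apply, pbwX_single, pbwMap_single, map_mul, aeval_X, mul_assoc,
        LinearMap.mulLeft_apply]
  exact LinearMap.congr_fun h v

theorem pbwMap_pbwY (v : ℕ →₀ ℂ[X]) : pbwMap lam (pbwY lam v) = genY lam * pbwMap lam v := by
  have h : pbwMap lam ∘ₗ pbwY lam = LinearMap.mulLeft ℂ (genY lam) ∘ₗ pbwMap lam :=
    Finsupp.lhom_ext fun n p => by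
      simp only [LinearMap.comp_apply, pbwY_single, pbwMap_single, LinearMap.mulLeft_apply]
      rw [← mul_assoc, genY_mul_aeval, mul_assoc, pow_succ']
  exact LinearMap.congr_fun h v

/-- Applied to the vector `1`, this linearity writes every `u` in normal form, so `pbwMap` is onto.
-/
theorem pbwMap_pbwAction (u : U lam) (v : ℕ →₀ ℂ[X]) :
    pbwMap lam (pbwAction lam u v) = u * pbwMap lam v := by
  let S : Subalgebra ℂ (U lam) :=
    { carrier := {u | ∀ v, pbwMap lam (pbwAction lam u v) = u * pbwMap lam v}
      mul_mem' := fun {a b} ha hb v => by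
        rw [map_mul, Module.End.mul_apply, ha, hb, mul_assoc]
      add_mem' := fun {a b} ha hb v => by
        rw [map_add, LinearMap.add_apply, map_add, ha, hb, add_mul]
      algebraMap_mem' := fun t v => by
        rw [AlgHom.commutes, Module.algebraMap_end_apply, map_smul, Algebra.smul_def] }
  refine mem_of_gen_mem S (fun v => ?_) (fun v => ?_) u v
  · rw [pbwAction, liftGen_genX, pbwMap_pbwX]
  · rw [pbwAction, liftGen_genY, pbwMap_pbwY]

/-- Acting on the vector `1` reads the coefficients off a normal form, so `pbwMap` is injective. -/
theorem pbwAction_pbwMap (v : ℕ →₀ ℂ[X]) :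
    pbwAction lam (pbwMap lam v) (Finsupp.single 0 1) = v := by
  have hY (n : ℕ) : (pbwY lam ^ n) (Finsupp.single 0 1) = Finsupp.single n 1 := by
    induction n with
    | zero => rfl
    | succ n ih => rw [pow_succ', Module.End.mul_apply, ih, pbwY_single, map_one]
  have hX (n : ℕ) (p : ℂ[X]) : aeval pbwX p (Finsupp.single n 1) = Finsupp.single n p := by
    induction p using Polynomial.induction_on with
    | C t =>
      rw [aeval_C, Module.algebraMap_end_apply, Finsupp.smul_single, smul_eq_C_mul, mul_one]
    | add p q hp hq => rw [map_add, LinearMap.add_apply, hp, hq, Finsupp.single_add]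
    | monomial m t h =>
      rw [pow_succ, ← mul_assoc, mul_comm, map_mul, Module.End.mul_apply, h, aeval_X, pbwX_single]
  have h : LinearMap.applyₗ (Finsupp.single 0 (1 : ℂ[X])) ∘ₗ (pbwAction lam).toLinearMap ∘ₗ
      pbwMap lam = LinearMap.id :=
    Finsupp.lhom_ext fun n p => by
      simp only [LinearMap.comp_apply, pbwMap_single, AlgHom.toLinearMap_apply, map_mul, map_pow,
        LinearMap.applyₗ_apply_apply, Module.End.mul_apply, LinearMap.id_apply, ← aeval_algHom_apply]
      rw [pbwAction, liftGen_genX, liftGen_genY, hY, hX]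
  exact LinearMap.congr_fun h v

/-- The Poincaré–Birkhoff–Witt isomorphism `⊕ₖ ℂ[X] Yᵏ ≃ U(g_κ)`. -/
def pbwEquiv : (ℕ →₀ ℂ[X]) ≃ₗ[ℂ] U lam :=
  LinearEquiv.ofBijective (pbwMap lam)
    ⟨Function.LeftInverse.injective (g := fun u => pbwAction lam u (Finsupp.single 0 1))
      (pbwAction_pbwMap lam),
     fun u => ⟨pbwAction lam u (Finsupp.single 0 1), by
      rw [pbwMap_pbwAction, pbwMap_single, map_one, pow_zero, one_mul, mul_one]⟩⟩

theorem pbwEquiv_single (n : ℕ) (p : ℂ[X]) :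
    pbwEquiv lam (Finsupp.single n p) = aeval (genX lam) p * genY lam ^ n := pbwMap_single lam n p

variable {lam}

/-- Linear maps out of `U(g_κ)` satisfy recursions along right multiplication by `x₂`. -/
theorem exists_linearMap_mul_genY {N : Type*} [AddCommGroup N] [Module ℂ N] (R : N →ₗ[ℂ] N)
    (F : U lam →ₗ[ℂ] N) :
    ∃ j : U lam →ₗ[ℂ] N, j 1 = 0 ∧ ∀ c, j (c * genY lam) = R (j c) - F c := by
  -- `G n` is `j` on `ℂ[x₁] x₂ⁿ`. Right multiplication by `x₂` moves this summand to the next with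
  -- the same polynomial, so the recursion determines `j` from the value `0` on `ℂ[x₁]`.
  let G : ℕ → (ℂ[X] →ₗ[ℂ] N) := fun n => Nat.rec 0
    (fun n g => R ∘ₗ g - F ∘ₗ (pbwEquiv lam).toLinearMap ∘ₗ Finsupp.lsingle n) n
  have hG (n : ℕ) (p : ℂ[X]) :
      G (n + 1) p = R (G n p) - F (pbwEquiv lam (Finsupp.single n p)) := rfl
  let j : U lam →ₗ[ℂ] N := Finsupp.lsum ℂ G ∘ₗ (pbwEquiv lam).symm.toLinearMap
  have hj (n : ℕ) (p : ℂ[X]) : j (aeval (genX lam) p * genY lam ^ n) = G n p := by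
    rw [← pbwEquiv_single]
    simp [j]
  refine ⟨j, ?_, fun c => ?_⟩
  · have := hj 0 1
    rwa [map_one, pow_zero, one_mul] at this
  · have h : (j ∘ₗ LinearMap.mulRight ℂ (genY lam)) ∘ₗ (pbwEquiv lam).toLinearMap =
        (R ∘ₗ j - F) ∘ₗ (pbwEquiv lam).toLinearMap := by
      refine Finsupp.lhom_ext fun n p => ?_
      simp only [LinearMap.comp_apply, LinearEquiv.coe_coe, pbwEquiv_single, LinearMap.sub_apply,
        LinearMap.mulRight_apply, mul_assoc, ← pow_succ, hj, hG]
    have := LinearMap.congr_fun h ((pbwEquiv lam).symm c)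
    simpa using this

end PBW

namespace Bimod

/-! ### Cocycles of degree two and of higher degree -/

section LowDegree

variable {k A N : Type*} [CommRing k] [Ring A] [Algebra k A] [AddCommGroup N] [Module k N]
  (B : Bimod k A N)

theorem coboundary_one (f : (Fin 1 → A) → N) (a b : A) :
    B.coboundary 1 f ![a, b] = B.l a (f ![b]) - f ![a * b] + B.r b (f ![a]) := by
  have h1 : Fin.contractNth (0 : Fin 2) (· * ·) ![a, b] = ![a * b] := by
    funext i; fin_cases i; rfl
  have h2 : Fin.init ![a, b] = ![a] := by funext i; fin_cases i; rfl
  have h3 : Fin.tail ![a, b] = ![b] := by funext i; fin_cases i; rfl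
  simp [coboundary, h1, h2, h3, sub_eq_add_neg]

theorem coboundary_two (f : (Fin 2 → A) → N) (a b c : A) :
    B.coboundary 2 f ![a, b, c] =
      B.l a (f ![b, c]) - f ![a * b, c] + f ![a, b * c] - B.r c (f ![a, b]) := by
  have h1 : Fin.contractNth (0 : Fin 3) (· * ·) ![a, b, c] = ![a * b, c] := by
    funext i; fin_cases i <;> rfl
  have h2 : Fin.contractNth (1 : Fin 3) (· * ·) ![a, b, c] = ![a, b * c] := by
    funext i; fin_cases i <;> rfl
  have h3 : Fin.init ![a, b, c] = ![a, b] := by funext i; fin_cases i <;> rfl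
  have h4 : Fin.tail ![a, b, c] = ![b, c] := by funext i; fin_cases i <;> rfl
  simp [coboundary, Fin.sum_univ_two, h1, h2, h3, h4, pow_succ]
  abel

/-- A multilinear map of two variables as a bilinear map. -/
def toBilinear (f : MultilinearMap k (fun _ : Fin 2 => A) N) : A →ₗ[k] A →ₗ[k] N :=
  LinearMap.mk₂ k (fun a b => f ![a, b])
    (fun a a' b => f.cons_add ![b] a a') (fun t a b => f.cons_smul ![b] t a)
    (fun a b b' => (f.curryLeft a).cons_add ![] b b')
    (fun t a b => (f.curryLeft a).cons_smul ![] t b)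

theorem toBilinear_apply (f : MultilinearMap k (fun _ : Fin 2 => A) N) (a b : A) :
    toBilinear f a b = f ![a, b] := rfl

end LowDegree

section Enveloping

variable {lam : ℝ}

/-- The linearization of the relation `x₁ x₂ - x₂ x₁ = i lam x₂`: the map
`(n₁, n₂) ↦ [x₁, n₂] - i lam n₂ + [n₁, x₂]`. -/
def relator {N : Type*} [AddCommGroup N] [Module ℂ N] (B : Bimod ℂ (U lam) N) (n₁ n₂ : N) : N :=
  B.l (genX lam) n₂ - B.r (genX lam) n₂ - (Complex.I * lam) • n₂
    + (B.r (genY lam) n₁ - B.l (genY lam) n₁)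

/-- If the relator is surjective, then every cocycle of degree two is a coboundary. -/
theorem exists_coboundary_of_relator {N : Type*} [AddCommGroup N] [Module ℂ N]
    (B : Bimod ℂ (U lam) N) (hB : ∀ n, ∃ n₁ n₂, B.relator n₁ n₂ = n)
    (f : MultilinearMap ℂ (fun _ : Fin 2 => U lam) N) (hf : ∀ a, B.coboundary 2 f a = 0) :
    ∃ g : MultilinearMap ℂ (fun _ : Fin 1 => U lam) N, ∀ a, f a = B.coboundary 1 g a := by
  obtain ⟨n₁, n₂, h⟩ := hB (f ![genY lam, genX lam] - f ![genX lam, genY lam])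
  obtain ⟨g, -, -, hg⟩ := B.exists_coboundary_two (toBilinear f)
    (fun a b c => (B.coboundary_two f a b c).symm.trans (hf _)) n₁ n₂ (by
      simp only [toBilinear_apply]
      rw [relator, ← sub_eq_zero] at h
      rw [← sub_eq_zero, ← h]
      abel)
  -- The splitting satisfies `g(ab) = a g(b) + g(a) b + f(a, b)`, so the coboundary of `g` is `-f`.
  refine ⟨MultilinearMap.ofSubsingleton ℂ (U lam) N 0 (-g), fun a => ?_⟩
  have ha : a = ![a 0, a 1] := by funext i; fin_cases i <;> rfl
  rw [ha, coboundary_one]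
  simp only [MultilinearMap.ofSubsingleton_apply_apply, Matrix.cons_val_fin_one,
    LinearMap.neg_apply, hg, map_neg, toBilinear_apply]
  abel

/-- The choice `j₂ = 0` suffices: it leaves `j(c) x₂ - j(c x₂) + c j(x₂) = F(c)`, a recursion along
right multiplication by `x₂`. The term `c j(x₂)` drops out, since `j(1) = F(1) = 0` forces `j(x₂) =
0`. -/
theorem relator_reduced_surjective {N : Type*} [AddCommGroup N] [Module ℂ N]
    (B : Bimod ℂ (U lam) N) (F : Reduced ℂ (U lam) N) :
    ∃ j₁ j₂, B.reduced.relator j₁ j₂ = F := by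
  obtain ⟨j, hj1, hj⟩ := exists_linearMap_mul_genY (B.r (genY lam)) F.1
  have hjY : j (genY lam) = 0 := by
    have := hj 1
    rwa [one_mul, hj1, map_zero, Reduced.apply_one, sub_zero] at this
  refine ⟨⟨j, hj1⟩, 0, Subtype.ext (LinearMap.ext fun c => ?_)⟩
  simp only [relator, map_zero, smul_zero, sub_zero, zero_add, Submodule.coe_sub,
    LinearMap.sub_apply, reduced_l_apply, reduced_r_apply, hj, hjY]
  abel

/-- The Hochschild cohomology of `U(g_κ)` vanishes in degrees at least three. -/
theorem exists_coboundary_of_three_le (n : ℕ) {N : Type} [AddCommGroup N] [Module ℂ N]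
    (B : Bimod ℂ (U lam) N) (f : MultilinearMap ℂ (fun _ : Fin (n + 3) => U lam) N)
    (hf : ∀ a, B.coboundary (n + 3) f a = 0) :
    ∃ g : MultilinearMap ℂ (fun _ : Fin (n + 2) => U lam) N,
      ∀ a, f a = B.coboundary (n + 2) g a := by
  -- `N` must vary, since each step trades one degree for passage to `B.reduced`.
  induction n generalizing N with
  | zero =>
    exact B.exists_coboundary_of_reduced 1
      (B.reduced.exists_coboundary_of_relator B.relator_reduced_surjective) f hf
  | succ n ih => exact B.exists_coboundary_of_reduced (n + 2) (ih B.reduced) f hf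

/-- Every `n : N` is the value of a cocycle of degree two on the relation
`x₁ x₂ - x₂ x₁ = i lam x₂`. -/
theorem exists_cocycle_two {N : Type*} [AddCommGroup N] [Module ℂ N]
    (B : Bimod ℂ (U lam) N) (n : N) :
    ∃ f : MultilinearMap ℂ (fun _ : Fin 2 => U lam) N, (∀ a, B.coboundary 2 f a = 0) ∧
      f ![genX lam, genY lam] - f ![genY lam, genX lam] = n := by
  -- Here `F(c) = c n` gives `j(x₂) = -n`, so `c j(x₂)` cancels `F(c)` and `j` commutes with `x₂`.
  -- Hence `x₁ ↦ j`, `x₂ ↦ 0` extends to a derivation `g`, and `f(c, a) = g(a)(c)` is the required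
  -- cocycle.
  obtain ⟨j, hj1, hj⟩ := exists_linearMap_mul_genY (B.r (genY lam)) (B.l.flip n)
  have hjY : j (genY lam) = -n := by
    have := hj 1
    rwa [one_mul, hj1, map_zero, LinearMap.flip_apply, B.l_one, zero_sub] at this
  obtain ⟨g, hgX, hgY, hg⟩ := B.reduced.exists_coboundary_two 0 (by simp) ⟨j, hj1⟩ 0 (by
    refine Subtype.ext (LinearMap.ext fun c => ?_)
    simp [reduced_l_apply, reduced_r_apply, hj, hjY])
  refine ⟨uncurryReduced (MultilinearMap.ofSubsingleton ℂ (U lam) _ 0 g), fun a => ?_, ?_⟩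
  · have h := coboundary_reduced B 1 (MultilinearMap.ofSubsingleton ℂ (U lam) _ 0 g) (a 0)
      (Fin.tail a)
    have ha : Fin.tail a = ![a 1, a 2] := by funext i; fin_cases i <;> rfl
    have h0 : B.reduced.coboundary 1 (MultilinearMap.ofSubsingleton ℂ (U lam) _ 0 g)
        (Fin.tail a) = 0 := by
      rw [ha, coboundary_one]
      simp only [MultilinearMap.ofSubsingleton_apply_apply, Matrix.cons_val_fin_one, hg]
      simp
    rw [h0, Fin.cons_self_tail] at h
    exact neg_eq_zero.mp h.symm
  · simp only [uncurryReduced_apply, MultilinearMap.ofSubsingleton_apply_apply]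
    show (g (genY lam)).1 (genX lam) - (g (genX lam)).1 (genY lam) = n
    rw [hgX, hgY, hjY]
    simp

end Enveloping

end Bimod

/-! ### Duality between Hochschild homology and cohomology -/

section Functionals

variable {k A M : Type*} [CommRing k] [Ring A] [Algebra k A] [AddCommGroup M] [Module k M]

/-- The cochain with values in the dual of `M` defined by a functional on the chains. -/
def toCochain {n : ℕ} (φ : HochschildChain k A M n →ₗ[k] k) :
    MultilinearMap k (fun _ : Fin n => A) (Module.Dual k M) :=
  (TensorProduct.curry φ).flip.compMultilinearMap (PiTensorProduct.tprod k)

theorem toCochain_apply {n : ℕ} (φ : HochschildChain k A M n →ₗ[k] k) (a : Fin n → A) (m : M) :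
    toCochain φ a m = φ (m ⊗ₜ[k] PiTensorProduct.tprod k a) := rfl

/-- The functional on the chains defined by a cochain with values in the dual of `M`. -/
def ofCochain {n : ℕ} (f : MultilinearMap k (fun _ : Fin n => A) (Module.Dual k M)) :
    HochschildChain k A M n →ₗ[k] k :=
  TensorProduct.lift (PiTensorProduct.lift f).flip

theorem ofCochain_tmul_tprod {n : ℕ}
    (f : MultilinearMap k (fun _ : Fin n => A) (Module.Dual k M)) (a : Fin n → A) (m : M) :
    ofCochain f (m ⊗ₜ[k] PiTensorProduct.tprod k a) = f a m := by
  simp [ofCochain]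

theorem toCochain_ofCochain {n : ℕ}
    (f : MultilinearMap k (fun _ : Fin n => A) (Module.Dual k M)) :
    toCochain (ofCochain f) = f :=
  MultilinearMap.ext fun a => LinearMap.ext fun m => ofCochain_tmul_tprod f a m

theorem hochschildChain_hom_ext {n : ℕ} {φ ψ : HochschildChain k A M n →ₗ[k] k}
    (h : ∀ a m, toCochain φ a m = toCochain ψ a m) : φ = ψ := by
  refine TensorProduct.ext (LinearMap.ext fun m => PiTensorProduct.ext ?_)
  exact MultilinearMap.ext fun a => h a m

end Functionals

section Duality

variable {k A : Type*} [CommRing k] [Ring A] [Algebra k A]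

variable (k A) in
/-- The dual of a bimodule, `(a ξ)(m) = ξ(m a)` and `(ξ a)(m) = ξ(a m)`. -/
def dualBimod (M : Type*) [AddCommGroup M] [Module k M] [Module A M] [Module Aᵐᵒᵖ M]
    [SMulCommClass A Aᵐᵒᵖ M] [IsScalarTower k A M] [IsScalarTower k Aᵐᵒᵖ M] :
    Bimod k A (Module.Dual k M) :=
  have hr (c : k) (x : Aᵐᵒᵖ) (m : M) : x • c • m = c • x • m := by
    rw [← algebraMap_smul Aᵐᵒᵖ c m, ← algebraMap_smul Aᵐᵒᵖ c (x • m), smul_smul, smul_smul,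
      Algebra.commutes]
  { l := LinearMap.mk₂ k
      (fun a ξ =>
        { toFun := fun m => ξ (MulOpposite.op a • m)
          map_add' := fun m m' => by rw [smul_add, map_add]
          map_smul' := fun c m => by rw [hr, map_smul, RingHom.id_apply] })
      (fun a a' ξ => LinearMap.ext fun m => by
        simp [add_smul])
      (fun c a ξ => LinearMap.ext fun m => by
        simp)
      (fun a ξ ξ' => LinearMap.ext fun m => by simp)
      (fun c a ξ => LinearMap.ext fun m => by simp)
    r := LinearMap.mk₂ k
      (fun a ξ =>
        { toFun := fun m => ξ (a • m)
          map_add' := fun m m' => by rw [smul_add, map_add]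
          map_smul' := fun c m => by rw [smul_comm, map_smul, RingHom.id_apply] })
      (fun a a' ξ => LinearMap.ext fun m => by
        simp [add_smul])
      (fun c a ξ => LinearMap.ext fun m => by
        simp)
      (fun a ξ ξ' => LinearMap.ext fun m => by simp)
      (fun c a ξ => LinearMap.ext fun m => by simp)
    l_one := fun ξ => LinearMap.ext fun m => by simp
    r_one := fun ξ => LinearMap.ext fun m => by simp
    l_mul := fun a b ξ => LinearMap.ext fun m => by simp [mul_smul]
    r_mul := fun a b ξ => LinearMap.ext fun m => by simp [mul_smul]
    l_r := fun a b ξ => LinearMap.ext fun m => by simp [smul_comm] }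

variable {M : Type*} [AddCommGroup M] [Module k M] [Module A M] [Module Aᵐᵒᵖ M]
    [SMulCommClass A Aᵐᵒᵖ M] [IsScalarTower k A M] [IsScalarTower k Aᵐᵒᵖ M]

theorem dualBimod_l_apply (a : A) (ξ : Module.Dual k M) (m : M) :
    (dualBimod k A M).l a ξ m = ξ (MulOpposite.op a • m) := rfl

theorem dualBimod_r_apply (a : A) (ξ : Module.Dual k M) (m : M) :
    (dualBimod k A M).r a ξ m = ξ (a • m) := rfl

/-- The transpose of the Hochschild boundary is the Hochschild coboundary. -/
theorem toCochain_comp_hochschildBoundary (n : ℕ) (φ : HochschildChain k A M n →ₗ[k] k)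
    (a : Fin (n + 1) → A) :
    toCochain (φ ∘ₗ hochschildBoundary k n) a = (dualBimod k A M).coboundary n (toCochain φ) a := by
  refine LinearMap.ext fun m => ?_
  rw [toCochain_apply, LinearMap.comp_apply, hochschildBoundary_tmul_tprod]
  simp only [hochschildBoundaryFun, Bimod.coboundary, map_add, map_sum, map_smul,
    LinearMap.add_apply, LinearMap.sum_apply, LinearMap.smul_apply, dualBimod_l_apply,
    dualBimod_r_apply, toCochain_apply]

end Duality

section DualityField

variable {k A : Type*} [Field k] [Ring A] [Algebra k A]
variable {M : Type*} [AddCommGroup M] [Module k M] [Module A M] [Module Aᵐᵒᵖ M]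
    [SMulCommClass A Aᵐᵒᵖ M] [IsScalarTower k A M] [IsScalarTower k Aᵐᵒᵖ M]

theorem nontrivial_hochschildHomology_succ_iff {k A M : Type*} [CommRing k] [Ring A]
    [Algebra k A] [AddCommGroup M] [Module k M] [Module A M] [Module Aᵐᵒᵖ M]
    [IsScalarTower k A M] [IsScalarTower k Aᵐᵒᵖ M] (n : ℕ) :
    Nontrivial (HochschildHomology k A M (n + 1)) ↔
      ¬ LinearMap.ker (hochschildBoundary (A := A) (M := M) k n) ≤
        LinearMap.range (hochschildBoundary (A := A) (M := M) k (n + 1)) := by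
  rw [← not_subsingleton_iff_nontrivial, Submodule.Quotient.subsingleton_iff,
    Submodule.submoduleOf_eq_top]
  rfl

/-- Hochschild homology vanishes where the cohomology of the dual bimodule does. -/
theorem not_nontrivial_hochschildHomology (n : ℕ)
    (H : ∀ f : MultilinearMap k (fun _ : Fin (n + 1) => A) (Module.Dual k M),
      (∀ a, (dualBimod k A M).coboundary (n + 1) f a = 0) →
        ∃ g : MultilinearMap k (fun _ : Fin n => A) (Module.Dual k M),
          ∀ a, f a = (dualBimod k A M).coboundary n g a) :
    ¬ Nontrivial (HochschildHomology k A M (n + 1)) := by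
  rw [nontrivial_hochschildHomology_succ_iff, not_not]
  intro z hz
  by_contra hz'
  -- Over a field, a functional separates `z` from the boundaries; as a cochain it is a cocycle.
  obtain ⟨φ, hφz, hφ⟩ := Submodule.exists_dual_map_eq_bot_of_notMem hz' inferInstance
  have hφ0 : φ ∘ₗ hochschildBoundary k (n + 1) = 0 := by
    rw [← LinearMap.range_eq_bot, LinearMap.range_comp, hφ]
  obtain ⟨g, hg⟩ := H (toCochain φ) fun a => by
    rw [← toCochain_comp_hochschildBoundary, hφ0]
    rfl
  have h : φ = ofCochain g ∘ₗ hochschildBoundary k n :=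
    hochschildChain_hom_ext fun a m => by
      rw [toCochain_comp_hochschildBoundary, toCochain_ofCochain, hg]
  rw [h, LinearMap.comp_apply, LinearMap.mem_ker.mp hz, map_zero] at hφz
  exact hφz rfl

/-- A cycle on which some cocycle does not vanish is not a boundary. -/
theorem nontrivial_hochschildHomology (n : ℕ) (z : HochschildChain k A M (n + 1))
    (hz : hochschildBoundary k n z = 0)
    (f : MultilinearMap k (fun _ : Fin (n + 1) => A) (Module.Dual k M))
    (hf : ∀ a, (dualBimod k A M).coboundary (n + 1) f a = 0) (hfz : ofCochain f z ≠ 0) :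
    Nontrivial (HochschildHomology k A M (n + 1)) := by
  rw [nontrivial_hochschildHomology_succ_iff]
  intro h
  obtain ⟨w, rfl⟩ := h (LinearMap.mem_ker.mpr hz)
  have h0 : ofCochain f ∘ₗ hochschildBoundary k (n + 1) = 0 :=
    hochschildChain_hom_ext fun a m => by
      rw [toCochain_comp_hochschildBoundary, toCochain_ofCochain, hf]
      rfl
  exact hfz (LinearMap.congr_fun h0 w)

end DualityField

/-! ### Homology in degree two -/

section DegreeTwo

variable {lam : ℝ} {M : Type*} [AddCommGroup M] [Module ℂ M] [Module (U lam) M]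
  [Module (U lam)ᵐᵒᵖ M] [SMulCommClass (U lam) (U lam)ᵐᵒᵖ M] [IsScalarTower ℂ (U lam) M]
  [IsScalarTower ℂ (U lam)ᵐᵒᵖ M]

/-- The chain `m ⊗ x₁ ∧ x₂` is a cycle of the Chevalley–Eilenberg complex. -/
def IsTopCycle (m : M) : Prop :=
  adRep (k := ℂ) (L := Lie lam) M (Lie.x₁ lam) m = -((Complex.I * lam) • m) ∧
    adRep (k := ℂ) (L := Lie lam) M (Lie.x₂ lam) m = 0

theorem adRep_x₁ (m : M) : adRep (k := ℂ) (L := Lie lam) M (Lie.x₁ lam) m =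
    genX lam • m - MulOpposite.op (genX lam) • m := rfl

theorem adRep_x₂ (m : M) : adRep (k := ℂ) (L := Lie lam) M (Lie.x₂ lam) m =
    genY lam • m - MulOpposite.op (genY lam) • m := rfl

theorem hochschildBoundary_one {k A M : Type*} [CommRing k] [Ring A] [Algebra k A]
    [AddCommGroup M] [Module k M] [Module A M] [Module Aᵐᵒᵖ M] [IsScalarTower k A M]
    [IsScalarTower k Aᵐᵒᵖ M] (m : M) (a b : A) :
    hochschildBoundary k 1 (m ⊗ₜ[k] PiTensorProduct.tprod k ![a, b]) =
      (MulOpposite.op a • m) ⊗ₜ[k] PiTensorProduct.tprod k ![b]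
        - m ⊗ₜ[k] PiTensorProduct.tprod k ![a * b]
        + (b • m) ⊗ₜ[k] PiTensorProduct.tprod k ![a] := by
  have h1 : Fin.contractNth (0 : Fin 2) (· * ·) ![a, b] = ![a * b] := by
    funext i; fin_cases i; rfl
  have h2 : Fin.init ![a, b] = ![a] := by funext i; fin_cases i; rfl
  have h3 : Fin.tail ![a, b] = ![b] := by funext i; fin_cases i; rfl
  rw [hochschildBoundary_tmul_tprod]
  simp [hochschildBoundaryFun, h1, h2, h3, sub_eq_add_neg]

/-- The Hochschild cycle `m ⊗ (x₁ ⊗ x₂ - x₂ ⊗ x₁)`. -/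
theorem IsTopCycle.hochschildBoundary_eq_zero {m : M} (hm : IsTopCycle (lam := lam) m) :
    hochschildBoundary ℂ 1 (m ⊗ₜ[ℂ] PiTensorProduct.tprod ℂ ![genX lam, genY lam]
      - m ⊗ₜ[ℂ] PiTensorProduct.tprod ℂ ![genY lam, genX lam]) = 0 := by
  let θ : U lam →ₗ[ℂ] ⨂[ℂ]^1 (U lam) :=
    (MultilinearMap.ofSubsingleton ℂ (U lam) _ 0).symm (PiTensorProduct.tprod ℂ)
  have hθ (u : U lam) : PiTensorProduct.tprod ℂ ![u] = θ u := by
    show _ = PiTensorProduct.tprod ℂ fun _ => u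
    congr 1
    funext i; fin_cases i; rfl
  obtain ⟨h1, h2⟩ := hm
  rw [adRep_x₁, sub_eq_iff_eq_add] at h1
  rw [adRep_x₂, sub_eq_zero] at h2
  have h3 : m ⊗ₜ[ℂ] θ (genX lam * genY lam) =
      (Complex.I * lam) • (m ⊗ₜ[ℂ] θ (genY lam)) + m ⊗ₜ[ℂ] θ (genY lam * genX lam) := by
    rw [← TensorProduct.tmul_smul, ← map_smul, ← genX_mul_genY_sub, ← TensorProduct.tmul_add,
      ← map_add, sub_add_cancel]
  -- The boundary equals `-([x₁, m] + iλm) ⊗ x₂ + [x₂, m] ⊗ x₁`, as in the Chevalley–Eilenberg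
  -- complex.
  rw [map_sub, hochschildBoundary_one, hochschildBoundary_one]
  simp only [hθ, h1, h2, h3, TensorProduct.add_tmul, TensorProduct.neg_tmul,
    ← TensorProduct.smul_tmul']
  abel

/-- The second Hochschild homology of `U(g_κ)` is governed by the top degree cycles of the
Chevalley–Eilenberg complex. -/
theorem nontrivial_hochschildHomology_two_iff :
    Nontrivial (HochschildHomology ℂ (U lam) M 2) ↔ ∃ m : M, m ≠ 0 ∧ IsTopCycle (lam := lam) m := by
  constructor
  · intro h
    by_contra! hM
    refine not_nontrivial_hochschildHomology (k := ℂ) (A := U lam) (M := M) 1 ?_ h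
    refine Bimod.exists_coboundary_of_relator _ fun n => ?_
    -- The kernel of `D` is the space of top cycles and its transpose is the relator of the dual
    -- bimodule. The sign of the first component arises because left multiplication on `M*` is dual
    -- to right multiplication on `M`.
    let D : M →ₗ[ℂ] M × M :=
      (-adRep (k := ℂ) (L := Lie lam) M (Lie.x₁ lam)
        - (Complex.I * lam) • LinearMap.id (R := ℂ) (M := M)).prod
        (adRep (k := ℂ) (L := Lie lam) M (Lie.x₂ lam))
    have hD : Function.Injective D := by
      rw [injective_iff_map_eq_zero]
      intro m hm
      by_contra hm0
      have h1 := congrArg Prod.fst hm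
      have h2 := congrArg Prod.snd hm
      refine hM m hm0 ⟨?_, h2⟩
      have h1' : -adRep (k := ℂ) (L := Lie lam) M (Lie.x₁ lam) m - (Complex.I * lam) • m = 0 := h1
      rw [← sub_eq_zero.mp h1', neg_neg]
    obtain ⟨θ, hθ⟩ := LinearMap.dualMap_surjective_of_injective hD n
    refine ⟨θ ∘ₗ LinearMap.inr ℂ M M, θ ∘ₗ LinearMap.inl ℂ M M, LinearMap.ext fun m => ?_⟩
    rw [← hθ]
    have hDm : D m = LinearMap.inl ℂ M M (-(genX lam • m - MulOpposite.op (genX lam) • m)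
        - (Complex.I * lam) • m) + LinearMap.inr ℂ M M
        (genY lam • m - MulOpposite.op (genY lam) • m) := by
      refine Prod.ext ?_ ?_
      · simp [D, adRep_x₁]
      · simp [D, adRep_x₂]
    rw [LinearMap.dualMap_apply, hDm]
    simp only [Bimod.relator, LinearMap.add_apply, LinearMap.sub_apply, LinearMap.smul_apply,
      dualBimod_l_apply, dualBimod_r_apply, LinearMap.comp_apply, map_add, map_sub, map_smul,
      map_neg]
    abel
  · rintro ⟨m, hm0, hm⟩
    obtain ⟨ξ, hξ⟩ := Module.Projective.exists_dual_ne_zero ℂ hm0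
    obtain ⟨f, hf, hfξ⟩ := (dualBimod ℂ (U lam) M).exists_cocycle_two ξ
    refine nontrivial_hochschildHomology 1 _ hm.hochschildBoundary_eq_zero f hf ?_
    rw [map_sub, ofCochain_tmul_tprod, ofCochain_tmul_tprod, ← LinearMap.sub_apply, hfξ]
    exact hξ

end DegreeTwo

/-! ### The Chevalley–Eilenberg complex in top degree -/

section TopDegree

variable (lam : ℝ)

/-- The standard basis vector `x₁ ∧ x₂` of `Λ² g_κ`. -/
def topVector : ⋀[ℂ]^2 (Lie lam) := exteriorPower.ιMulti ℂ 2 ![Lie.x₁ lam, Lie.x₂ lam]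

/-- The coordinate functionals on `g_κ`. -/
def Lie.coord (i : Fin 2) : Lie lam →ₗ[ℂ] ℂ where
  toFun v := v i
  map_add' _ _ := rfl
  map_smul' _ _ := rfl

/-- The functional on `Λ² g_κ` dual to `x₁ ∧ x₂`. -/
def topCoord : ⋀[ℂ]^2 (Lie lam) →ₗ[ℂ] ℂ :=
  exteriorPower.alternatingMapLinearEquiv
    ((Matrix.detRowAlternating (n := Fin 2) (R := ℂ)).compLinearMap
      (LinearMap.pi fun i => Lie.coord lam i))

theorem topCoord_ιMulti (v : Fin 2 → Lie lam) :
    topCoord lam (exteriorPower.ιMulti ℂ 2 v) = v 0 0 * v 1 1 - v 0 1 * v 1 0 := by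
  rw [topCoord, exteriorPower.alternatingMapLinearEquiv_apply_ιMulti]
  exact Matrix.det_fin_two _

theorem topCoord_topVector : topCoord lam (topVector lam) = 1 := by
  rw [topVector, topCoord_ιMulti]
  show (1 : ℂ) * 1 - 0 * 0 = 1
  norm_num

theorem _root_.AlternatingMap.map_vec_two_smul_add {R P Q : Type*} [CommRing R] [AddCommGroup P]
    [Module R P] [AddCommGroup Q] [Module R Q] (g : P [⋀^Fin 2]→ₗ[R] Q) (a b c d : R) (p q : P) :
    g ![a • p + b • q, c • p + d • q] = (a * d - b * c) • g ![p, q] := by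
  have u0 (w z : P) : Function.update ![0, z] 0 w = ![w, z] := by
    funext i; fin_cases i <;> simp
  have u1 (w z : P) : Function.update ![z, 0] 1 w = ![z, w] := by
    funext i; fin_cases i <;> simp
  have hl (x y z : P) : g ![x + y, z] = g ![x, z] + g ![y, z] := by
    simpa only [u0] using g.map_update_add ![0, z] 0 x y
  have hr (x y z : P) : g ![z, x + y] = g ![z, x] + g ![z, y] := by
    simpa only [u1] using g.map_update_add ![z, 0] 1 x y
  have sl (t : R) (x z : P) : g ![t • x, z] = t • g ![x, z] := by
    simpa only [u0] using g.map_update_smul ![0, z] 0 t x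
  have sr (t : R) (x z : P) : g ![z, t • x] = t • g ![z, x] := by
    simpa only [u1] using g.map_update_smul ![z, 0] 1 t x
  have h0 (x : P) : g ![x, x] = 0 := g.map_eq_zero_of_eq ![x, x] (i := 0) (j := 1) rfl (by simp)
  have hs : g ![q, p] = -g ![p, q] := by
    have := h0 (p + q)
    rw [hl, hr, hr, h0, h0, zero_add, add_zero] at this
    exact (neg_eq_of_add_eq_zero_right this).symm
  simp only [hl, hr, sl, sr, h0, hs]
  module

/-- `Λ² g_κ` is a line, so top degree chains are single tensors `m ⊗ x₁ ∧ x₂`. -/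
theorem topCoord_smul_topVector (ω : ⋀[ℂ]^2 (Lie lam)) :
    topCoord lam ω • topVector lam = ω := by
  have h : (topCoord lam).smulRight (topVector lam) = LinearMap.id := by
    refine exteriorPower.linearMap_ext (AlternatingMap.ext fun v => ?_)
    show topCoord lam (exteriorPower.ιMulti ℂ 2 v) • topVector lam = exteriorPower.ιMulti ℂ 2 v
    rw [topCoord_ιMulti]
    have hv : v = ![v 0 0 • Lie.x₁ lam + v 0 1 • Lie.x₂ lam,
        v 1 0 • Lie.x₁ lam + v 1 1 • Lie.x₂ lam] := by
      funext i
      fin_cases i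
      · exact Lie.eq_smul_add_smul (v 0)
      · exact Lie.eq_smul_add_smul (v 1)
    rw [congrArg (exteriorPower.ιMulti ℂ 2) hv, AlternatingMap.map_vec_two_smul_add]
    rfl
  exact LinearMap.congr_fun h ω

variable {lam} {M : Type*} [AddCommGroup M] [Module ℂ M]

theorem exists_eq_tmul_topVector (c : M ⊗[ℂ] (⋀[ℂ]^2 (Lie lam))) :
    ∃ m : M, c = m ⊗ₜ[ℂ] topVector lam := by
  induction c with
  | zero => exact ⟨0, (TensorProduct.zero_tmul _ _).symm⟩
  | tmul m ω =>
    exact ⟨topCoord lam ω • m, by rw [TensorProduct.smul_tmul, topCoord_smul_topVector]⟩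
  | add c c' h h' =>
    obtain ⟨m, rfl⟩ := h
    obtain ⟨m', rfl⟩ := h'
    exact ⟨m + m', (TensorProduct.add_tmul _ _ _).symm⟩

theorem tmul_topVector_ne_zero {m : M} (hm : m ≠ 0) : m ⊗ₜ[ℂ] topVector lam ≠ 0 := fun h => by
  have := congrArg (fun c => TensorProduct.rid ℂ M ((topCoord lam).lTensor M c)) h
  simp [topCoord_topVector] at this
  exact hm this

variable [Module (U lam) M] [Module (U lam)ᵐᵒᵖ M] [SMulCommClass (U lam) (U lam)ᵐᵒᵖ M]
  [IsScalarTower ℂ (U lam) M] [IsScalarTower ℂ (U lam)ᵐᵒᵖ M]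

theorem chevalleyEilenbergTwo_tmul_topVector_eq_zero_iff (m : M) :
    chevalleyEilenbergTwo (adRep (k := ℂ) (L := Lie lam) M) (m ⊗ₜ[ℂ] topVector lam) = 0 ↔
      IsTopCycle (lam := lam) m := by
  have h : chevalleyEilenbergTwo (adRep (k := ℂ) (L := Lie lam) M) (m ⊗ₜ[ℂ] topVector lam) =
      (-((Complex.I * lam) • m) - adRep (k := ℂ) (L := Lie lam) M (Lie.x₁ lam) m) ⊗ₜ[ℂ] Lie.x₂ lam
        + adRep (k := ℂ) (L := Lie lam) M (Lie.x₂ lam) m ⊗ₜ[ℂ] Lie.x₁ lam := by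
    rw [topVector, chevalleyEilenbergTwo_tmul]
    simp only [Matrix.cons_val_zero, Matrix.cons_val_one, Lie.lie_x₁_x₂, TensorProduct.tmul_smul,
      TensorProduct.sub_tmul, TensorProduct.neg_tmul, ← TensorProduct.smul_tmul']
  rw [h]
  constructor
  · intro h0
    have key (i : Fin 2) := congrArg
      (fun c => TensorProduct.rid ℂ M ((Lie.coord lam i).lTensor M c)) h0
    have h11 : Lie.coord lam 0 (Lie.x₁ lam) = 1 := rfl
    have h12 : Lie.coord lam 0 (Lie.x₂ lam) = 0 := rfl
    have h21 : Lie.coord lam 1 (Lie.x₁ lam) = 0 := rfl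
    have h22 : Lie.coord lam 1 (Lie.x₂ lam) = 1 := rfl
    have k0 := key 0
    have k1 := key 1
    simp only [map_add, LinearMap.lTensor_tmul, TensorProduct.rid_tmul, h11, h12, h21, h22,
      zero_smul, one_smul, zero_add, add_zero, map_zero] at k0 k1
    exact ⟨(sub_eq_zero.mp k1).symm, k0⟩
  · rintro ⟨h1, h2⟩
    rw [h1, h2, sub_self, TensorProduct.zero_tmul, TensorProduct.zero_tmul, add_zero]

/-- Nonzero top degree cycles of the Chevalley–Eilenberg complex. -/
theorem exists_chevalleyEilenbergTwo_eq_zero_iff :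
    (∃ c : M ⊗[ℂ] (⋀[ℂ]^2 (Lie lam)),
      c ≠ 0 ∧ chevalleyEilenbergTwo (adRep (k := ℂ) (L := Lie lam) M) c = 0) ↔
      ∃ m : M, m ≠ 0 ∧ IsTopCycle (lam := lam) m := by
  constructor
  · rintro ⟨c, hc, h⟩
    obtain ⟨m, rfl⟩ := exists_eq_tmul_topVector c
    refine ⟨m, fun hm => hc (by rw [hm, TensorProduct.zero_tmul]), ?_⟩
    exact (chevalleyEilenbergTwo_tmul_topVector_eq_zero_iff m).mp h
  · rintro ⟨m, hm, h⟩
    exact ⟨_, tmul_topVector_ne_zero hm,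
      (chevalleyEilenbergTwo_tmul_topVector_eq_zero_iff m).mpr h⟩

end TopDegree

/-! ### The twisted bimodules -/

section TwistedCycles

open Polynomial

theorem genX_mul_genY_pow_sub (lam : ℝ) (n : ℕ) :
    genX lam * genY lam ^ n - genY lam ^ n * genX lam =
      (n * (Complex.I * lam)) • genY lam ^ n := by
  induction n with
  | zero => simp
  | succ n ih =>
    have h : genX lam * genY lam ^ (n + 1) - genY lam ^ (n + 1) * genX lam =
        (genX lam * genY lam ^ n - genY lam ^ n * genX lam) * genY lam
          + genY lam ^ n * (genX lam * genY lam - genY lam * genX lam) := by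
      rw [pow_succ]
      noncomm_ring
    rw [h, ih, genX_mul_genY_sub, smul_mul_assoc, mul_smul_comm, ← pow_succ, ← add_smul]
    congr 1
    push_cast
    ring

/-- The commutator with `x₁` in the Poincaré–Birkhoff–Witt basis. -/
def pbwAd (lam : ℝ) : Module.End ℂ (ℕ →₀ ℂ[X]) :=
  Finsupp.lsum ℂ fun n => ((n : ℂ) * (Complex.I * lam)) • Finsupp.lsingle n

theorem pbwAd_apply (lam : ℝ) (v : ℕ →₀ ℂ[X]) (n : ℕ) :
    pbwAd lam v n = ((n : ℂ) * (Complex.I * lam)) • v n := by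
  have h : Finsupp.lapply n ∘ₗ pbwAd lam = ((n : ℂ) * (Complex.I * lam)) • Finsupp.lapply n :=
    Finsupp.lhom_ext fun m p => by
      by_cases hmn : m = n
      · subst hmn; simp [pbwAd]
      · simp [pbwAd, Finsupp.single_eq_of_ne' hmn]
  exact LinearMap.congr_fun h v

/-- Polynomials in `x₁` commute with `x₁`, so `ad x₁` only sees the factor `x₂ⁿ`, an eigenvector for
`niλ`. -/
theorem pbwEquiv_pbwAd (lam : ℝ) (v : ℕ →₀ ℂ[X]) :
    pbwEquiv lam (pbwAd lam v) = genX lam * pbwEquiv lam v - pbwEquiv lam v * genX lam := by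
  have h : (pbwEquiv lam).toLinearMap ∘ₗ pbwAd lam =
      (LinearMap.mulLeft ℂ (genX lam) - LinearMap.mulRight ℂ (genX lam)) ∘ₗ
        (pbwEquiv lam).toLinearMap :=
    Finsupp.lhom_ext fun n p => by
      have hc : genX lam * aeval (genX lam) p = aeval (genX lam) p * genX lam := by
        simpa using congrArg (aeval (genX lam)) (X_mul (p := p))
      have hs : pbwAd lam (Finsupp.single n p) =
          ((n : ℂ) * (Complex.I * lam)) • Finsupp.single n p := by
        simp [pbwAd]
      simp only [LinearMap.comp_apply, LinearEquiv.coe_coe, hs, map_smul, pbwEquiv_single,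
        LinearMap.sub_apply, LinearMap.mulLeft_apply, LinearMap.mulRight_apply]
      rw [← mul_smul_comm, ← genX_mul_genY_pow_sub, mul_sub, ← mul_assoc, ← mul_assoc, ← mul_assoc,
        hc]
  exact LinearMap.congr_fun h v

/-- The twist adds `iμ u` to `[x₁, u]`, which shifts the eigenvalue. -/
theorem isTopCycle_of_iff (lam : ℝ) (μ : ℂ) (u : U lam) :
    IsTopCycle (lam := lam) (TwistedBimodule.of (twist lam μ) u) ↔
      genX lam * u - u * genX lam = (-(Complex.I * (μ + lam))) • u ∧
        genY lam * u = u * genY lam := by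
  rw [IsTopCycle, adRep_x₁, adRep_x₂, TwistedBimodule.smul_def, TwistedBimodule.op_smul_def,
    TwistedBimodule.smul_def, TwistedBimodule.op_smul_def, LinearEquiv.symm_apply_apply,
    ← map_sub, ← map_sub, ← map_smul, ← map_neg, LinearEquiv.map_eq_zero_iff, sub_eq_zero,
    (TwistedBimodule.of (twist lam μ)).injective.eq_iff, genX, genY, twist_x₁, twist_x₂, add_mul,
    ← Algebra.smul_def]
  refine and_congr_left fun _ => ?_
  have h : (-(Complex.I * (μ + lam))) • u = -((Complex.I * lam) • u) - (Complex.I * μ) • u := by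
    module
  rw [h, eq_sub_iff_add_eq, add_sub_right_comm]

/-- The twisted bimodule has a nonzero top degree cycle exactly at the exceptional twists. -/
theorem exists_isTopCycle_iff (lam : ℝ) (μ : ℂ) :
    (∃ m : TwistedBimodule (twist lam μ), m ≠ 0 ∧ IsTopCycle (lam := lam) m) ↔
      ∃ b : ℕ, μ = -(lam : ℂ) * (1 + (b : ℂ)) := by
  constructor
  · rintro ⟨m, hm0, hm⟩
    obtain ⟨u, rfl⟩ := (TwistedBimodule.of (twist lam μ)).surjective m
    obtain ⟨v, rfl⟩ := (pbwEquiv lam).surjective u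
    rw [isTopCycle_of_iff, ← pbwEquiv_pbwAd, ← map_smul, (pbwEquiv lam).injective.eq_iff] at hm
    have hv : v ≠ 0 := fun h => hm0 (by rw [h, map_zero, map_zero])
    -- At a nonzero PBW component `b`, the eigenvalue `biλ` of `ad x₁` must equal `-i(μ + λ)`.
    obtain ⟨b, hb⟩ := Finsupp.ne_iff.mp hv
    have h := DFunLike.congr_fun hm.1 b
    rw [pbwAd_apply, Finsupp.smul_apply] at h
    have h' := smul_left_injective ℂ hb h
    refine ⟨b, mul_left_cancel₀ Complex.I_ne_zero ?_⟩
    linear_combination h'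
  · rintro ⟨b, rfl⟩
    refine ⟨TwistedBimodule.of _ (genY lam ^ b), ?_, ?_⟩
    · rw [Ne, LinearEquiv.map_eq_zero_iff]
      intro h
      have h1 : pbwEquiv lam (Finsupp.single b 1) = 0 := by
        rw [pbwEquiv_single, h, mul_zero]
      rw [LinearEquiv.map_eq_zero_iff, Finsupp.single_eq_zero] at h1
      exact one_ne_zero h1
    · rw [isTopCycle_of_iff, genX_mul_genY_pow_sub]
      refine ⟨?_, (pow_succ' _ _).symm.trans (pow_succ _ _)⟩
      congr 1
      ring

end TwistedCycles

/-- The twisted Hochschild dimension of `U(g_κ)`. -/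
theorem twistedHochschildDimension_eq_two (lam : ℝ) :
    twistedHochschildDimension ℂ (U lam) = 2 := by
  refine le_antisymm (iSup_le fun σ => iSup_le fun n => iSup_le fun hn => ?_) ?_
  · by_contra hn2
    obtain ⟨j, rfl⟩ : ∃ j, n = j + 3 := ⟨n - 3, by
      have : 2 < n := by exact_mod_cast not_le.mp hn2
      omega⟩
    exact not_nontrivial_hochschildHomology (k := ℂ) (A := U lam) (M := TwistedBimodule σ) (j + 2)
      (Bimod.exists_coboundary_of_three_le j _) hn
  -- The twist `μ = -λ` is the case `b = 0`, with top cycle `x₂⁰ = 1`.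
  · have h : Nontrivial (HochschildHomology ℂ (U lam) (TwistedBimodule (twist lam (-lam))) 2) :=
      nontrivial_hochschildHomology_two_iff.mpr
        ((exists_isTopCycle_iff lam _).mpr ⟨0, by simp⟩)
    exact le_iSup_of_le (twist lam (-lam)) (le_iSup_of_le 2 (le_iSup_of_le h le_rfl))

end KappaMinkowski

end

theorem mainTheorem2 (lam : ℝ) (hlam : lam ≠ 0) :
    KappaMinkowski.twistedHochschildDimension ℂ (KappaMinkowski.U lam) = 2 ∧
    ∀ μ : ℂ,
      ((∃ c : KappaMinkowski.TwistedBimodule (KappaMinkowski.twist lam μ) ⊗[ℂ]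
            (⋀[ℂ]^2 (KappaMinkowski.Lie lam)),
          c ≠ 0 ∧
          KappaMinkowski.chevalleyEilenbergTwo
            (KappaMinkowski.adRep (k := ℂ) (L := KappaMinkowski.Lie lam)
              (KappaMinkowski.TwistedBimodule (KappaMinkowski.twist lam μ))) c = 0) ↔
        ∃ b : ℕ, μ = -(lam : ℂ) * (1 + (b : ℂ))) ∧
      (Nontrivial (KappaMinkowski.HochschildHomology ℂ (KappaMinkowski.U lam)
          (KappaMinkowski.TwistedBimodule (KappaMinkowski.twist lam μ)) 2) ↔
        ∃ b : ℕ, μ = -(lam : ℂ) * (1 + (b : ℂ))) :=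
  ⟨KappaMinkowski.twistedHochschildDimension_eq_two lam, fun μ =>
    ⟨KappaMinkowski.exists_chevalleyEilenbergTwo_eq_zero_iff.trans
      (KappaMinkowski.exists_isTopCycle_iff lam μ),
     KappaMinkowski.nontrivial_hochschildHomology_two_iff.trans
      (KappaMinkowski.exists_isTopCycle_iff lam μ)⟩⟩
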